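/- Let $b\ge 2$ be an integer and let $A=(a_n)_{n\ge 1}$ be a strictly increasing sequence of positive integers such that the limit $\eta:=\lim_{n\to\infty}a_{n+1}/a_n$ exists and $1<\eta<\infty$. Let $\|x\|$ denote the distance from $x$ to the nearest integer, and for $\xi\in\mathbb R$ let $$\hat v_{b,A}(\xi):=\sup\Bigl\{v\ge 0:\ \text{for all sufficiently large } N,\ \min_{1\le n\le N}\|b^{a_n}\xi\|<(b^{a_N})^{-v}\Bigr\}\in[0,+\infty].$$ Put $$l_0=\max\Bigl\{1,\Bigl\lfloor\frac{\log 2-\log(\eta-1)}{\log\eta}\Bigr\rfloor+1\Bigr\}.$$ Then for every $$\hat v\in\Bigl(\max\Bigl\{1,\ \eta-\frac{\eta^{l_0}+\eta^{l_0+1}-1}{\eta^{2l_0}}\Bigr\},\ \eta-\frac{2}{\eta^{l_0}}\Bigr]\ \cup\ \bigcup_{l=l_0+1}^{\infty}\Bigl(\eta-\frac{\eta^{l}+\eta^{l+1}-1}{\eta^{2l}},\ \eta-\frac{2}{\eta^{l}}\Bigr]$$ we have, with $\dim_{\rm H}$ the Hausdorff dimension, $$\dim_{\rm H}\{\xi\in\mathbb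 R:\hat v_{b,A}(\xi)=\hat v\}=\dim_{\rm H}\{\xi\in\mathbb R:\hat v_{b,A}(\xi)\ge\hat v\}=\frac{\eta^{\tilde l+1}-1-\eta^{\tilde l}\hat v}{(\eta^{\tilde l+1}-1)(1+\eta^{\tilde l}\hat v)},$$ where $$\tilde l=\max\Bigl\{1,\Bigl\lfloor\frac{\log(\eta+1)-\log(\eta-\hat v)}{\log\eta}\Bigr\rfloor\Bigr\}.$$ Moreover, if $\hat v=\eta-2/\eta^{l}$ for some integer $l\ge l_0$, then these equalities hold and the common value equals $\bigl(\frac{\eta-\hat v}{\eta+\hat v}\bigr)^2$. -/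

import Mathlib

open Filter Topology Set

/-- Distance from a real number to the nearest integer, `‖x‖`. -/
noncomputable def distNearestInt (x : ℝ) : ℝ := |x - round x|

/-- The uniform exponent of approximation of `ξ` in base `b` along the sequence `a`:
the supremum (in the extended reals) of all `v ≥ 0` such that for all large `N` some term `a n`
with `n ≤ N` satisfies `‖b ^ (a n) * ξ‖ < (b ^ (a N)) ^ (-v)`.
Sequences are indexed from `0`, so `a 0` is the first term. -/
noncomputable def uniformExponent (b : ℕ) (a : ℕ → ℕ) (ξ : ℝ) : EReal :=
  sSup ((fun v : ℝ => (v : EReal)) '' {v : ℝ | 0 ≤ v ∧ ∀ᶠ N in atTop, ∃ n, n ≤ N ∧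
    distNearestInt ((b : ℝ) ^ (a n) * ξ) < ((b : ℝ) ^ (a N)) ^ (-v)})

/-- The real numbers whose uniform exponent is at least `v`. -/
def uniformGeSet (b : ℕ) (a : ℕ → ℕ) (v : ℝ) : Set ℝ :=
  {ξ : ℝ | (v : EReal) ≤ uniformExponent b a ξ}

/-- The real numbers whose uniform exponent is exactly `v`. -/
def uniformEqSet (b : ℕ) (a : ℕ → ℕ) (v : ℝ) : Set ℝ :=
  {ξ : ℝ | uniformExponent b a ξ = (v : EReal)}

/-- The integer `l₀ = max {1, ⌊(log 2 - log (η - 1)) / log η⌋ + 1}`. -/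
noncomputable def lZero (η : ℝ) : ℤ :=
  max 1 (⌊(Real.log 2 - Real.log (η - 1)) / Real.log η⌋ + 1)

/-- The integer `l̃ = max {1, ⌊(log (η + 1) - log (η - v)) / log η⌋}`. -/
noncomputable def lTilde (η v : ℝ) : ℤ :=
  max 1 ⌊(Real.log (η + 1) - Real.log (η - v)) / Real.log η⌋

/-- The number `η - (η ^ l + η ^ (l + 1) - 1) / η ^ (2 l)`. -/
noncomputable def lowerEnd (η : ℝ) (l : ℤ) : ℝ :=
  η - (η ^ l + η ^ (l + 1) - 1) / η ^ (2 * l)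

/-- The number `η - 2 / η ^ l`. -/
noncomputable def upperEnd (η : ℝ) (l : ℤ) : ℝ :=
  η - 2 / η ^ l

/-- The union of half-open intervals in which the exponent is prescribed. -/
noncomputable def exponentRange (η : ℝ) : Set ℝ :=
  Set.Ioc (max 1 (lowerEnd η (lZero η))) (upperEnd η (lZero η)) ∪
    ⋃ l : ℤ, ⋃ _ : lZero η + 1 ≤ l, Set.Ioc (lowerEnd η l) (upperEnd η l)

/-- The value
`(η ^ (l̃ + 1) - 1 - η ^ l̃ * v) / ((η ^ (l̃ + 1) - 1) * (1 + η ^ l̃ * v))`. -/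
noncomputable def dimValue (η v : ℝ) : ℝ :=
  (η ^ (lTilde η v + 1) - 1 - η ^ (lTilde η v) * v) /
    ((η ^ (lTilde η v + 1) - 1) * (1 + η ^ (lTilde η v) * v))

/-! Write `f n = ‖b ^ (a n) ξ‖` and discard the countably many `ξ` with some `f n = 0`. If `n` and
`n + d` are consecutive strict record minima of `f`, then `f n` is still the best value at time `n +
d - 1`, so exponent `v` forces `f n < b ^ (-(v * a (n + d - 1)))`: about `v η ^ (d - 1) a n` digits
of `ξ` after position `a n` are prescribed. If every gap is `d = l + 1`, the lower density of the
unprescribed digits is `dimFun η v (η ^ l)`, the worst places being the ends of the runs. The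
admissible range of `v` is what makes `l = l̃` optimal among constant gaps (`dimFun_le_dimFun`).

Upper bound: varying the gaps does not help. Let `(v / η) S a n` be the number of digits prescribed
before position `a n`; a gap `d` sends `S` to `1 + S / η ^ d`. For `s` above every `dimFun η v (η ^
d)`, covering directly by the short interval around a record is profitable as soon as `S + s η ^ d`
exceeds `(1 - s) η / v`, and `doomed_of_forall` shows that this cannot be postponed forever.
Well-founded induction along `Doomed` turns this into an exponential gain
(`exists_preHausdorff_recordSet_le`), and Borel–Cantelli gives measure zero.

Lower bound: put zeros on the runs given by the constant gap `l + 1` and the digits of `y ∈ [0, 1)`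
elsewhere (`spread`). The inverse of this map is Hölder with any exponent below the density. All
images have exponent at least `v`; by the upper bound at `v' > v` and `dimFun_lt_of_lt`, the `y`
giving a larger exponent form a Lebesgue null set, so exact exponent `v` keeps the full dimension.
-/

/-! ### Optimising the density over constant gaps. -/

/-- The dimension produced by runs of relative length `t * v` recurring with ratio `η * t`. -/
noncomputable def dimFun (η v t : ℝ) : ℝ :=
  (η * t - 1 - t * v) / ((η * t - 1) * (1 + t * v))

lemma dimFun_pos_of_two_le {η v t : ℝ} (hv : 0 < v) (ht : 1 ≤ t)
    (h2 : 2 ≤ t * (η - v)) : 0 < dimFun η v t := by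
  unfold dimFun
  have h1 : 0 < t * v := by positivity
  apply div_pos
  · nlinarith
  · apply mul_pos <;> nlinarith

/-- With `p = η - v`, the denominator is `(t * p - 1) + η * v * t ^ 2`, so `dimFun` increases with
`(t * p - 1) / t ^ 2`. The last hypothesis reflects that `t` and `t'` are powers of `η`: either `t'`
is no smaller or it is smaller by a full factor `η`. -/
lemma dimFun_le_dimFun {η v t t' : ℝ} (hη : 1 < η) (hv : 0 < v) (ht : 1 ≤ t) (ht' : 1 ≤ t')
    (h2 : 2 ≤ t * (η - v)) (h3 : t * (η - v) ≤ η + 1)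
    (h : t ≤ t' ∨ η * t' ≤ t) : dimFun η v t' ≤ dimFun η v t := by
  have hvt : 0 < t * v := by positivity
  have hvt' : 0 < t' * v := by positivity
  have hD' : 0 < (η * t' - 1) * (1 + t' * v) := by apply mul_pos <;> nlinarith
  have hD : 0 < (η * t - 1) * (1 + t * v) := by apply mul_pos <;> nlinarith
  by_cases hy : t' * (η - v) ≤ 1
  · refine le_trans ?_ (dimFun_pos_of_two_le hv ht h2).le
    exact div_nonpos_of_nonpos_of_nonneg (by nlinarith) hD'.le
  push Not at hy
  unfold dimFun
  rw [div_le_div_iff₀ hD' hD]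
  have hp : 0 < η - v := by
    by_contra hcon
    push Not at hcon
    nlinarith
  have key : (t' * (η - v) - 1) * t ^ 2 ≤ (t * (η - v) - 1) * t' ^ 2 := by
    set p := η - v
    -- The cross difference has the factor `t' - t`, and `(t * p - 1) * (t' * p - 1)` is at least
    -- `1` when `t ≤ t'` and at most `η * η⁻¹` when `η * t' ≤ t`. The bounds `2` and `η + 1` on `t *
    -- p` enter exactly here.
    have : 0 ≤ (t' - t) * ((t * p - 1) * (t' * p - 1) - 1) := by
      rcases h with h | h
      · apply mul_nonneg (by linarith)
        have h4 : 2 ≤ t' * p := by nlinarith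
        nlinarith
      · have h5 : η * (t' * p) ≤ t * p := by nlinarith
        have h6 : η * (t' * p - 1) ≤ 1 := by linarith
        have h7 : (t * p - 1) * (t' * p - 1) ≤ 1 := by
          have : (t * p - 1) * (t' * p - 1) ≤ η * (t' * p - 1) := by
            apply mul_le_mul_of_nonneg_right <;> linarith
          linarith
        apply mul_nonneg_of_nonpos_of_nonpos <;> nlinarith
    have h8 : (t' - t) * ((t * p - 1) * (t' * p - 1) - 1)
        = p * ((t * p - 1) * t' ^ 2 - (t' * p - 1) * t ^ 2) := by ring
    rw [h8] at this
    have := nonneg_of_mul_nonneg_right this hp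
    linarith
  have key2 := mul_le_mul_of_nonneg_left key (by positivity : 0 ≤ η * v)
  nlinarith [key2]

lemma dimFun_eq_sub {η v t : ℝ} (hη : 1 < η) (hv : 0 < v) (ht : 1 ≤ t) :
    dimFun η v t = (1 + t * v)⁻¹ * (1 + (η * t - 1)⁻¹) - (η * t - 1)⁻¹ := by
  have h1 : 0 < 1 + t * v := by positivity
  have h2 : 0 < η * t - 1 := by nlinarith
  unfold dimFun
  field_simp
  ring

/-- Increasing the exponent by a factor scales the dimension down uniformly in `t`. -/
lemma dimFun_lt_of_lt {η v v' D : ℝ} (hη : 1 < η) (hv : 0 < v) (hvv : v < v') (hD : 0 < D)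
    (h : ∀ d : ℕ, dimFun η v (η ^ d) ≤ D) :
    ∃ D', 0 < D' ∧ D' < D ∧ ∀ d : ℕ, dimFun η v' (η ^ d) ≤ D' := by
  have hr : (1 + v) / (1 + v') < 1 := by rw [div_lt_one] <;> linarith
  have hr0 : 0 < (1 + v) / (1 + v') := by apply div_pos <;> linarith
  -- Since `t ≥ 1`, the factor `(1 + t * v) / (1 + t * v')` is at most its value at `t = 1`, which
  -- gives a ratio independent of `t`.
  refine ⟨(1 + v) / (1 + v') * D, by positivity, by nlinarith, fun d => ?_⟩
  have ht : 1 ≤ η ^ d := one_le_pow₀ hη.le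
  specialize h d
  rw [dimFun_eq_sub hη hv ht] at h
  rw [dimFun_eq_sub hη (hv.trans hvv) ht]
  set t := η ^ d
  have h2 : 0 < η * t - 1 := by nlinarith
  set z := (η * t - 1)⁻¹
  have hz : 0 < z := by positivity
  have h3 : (1 + t * v')⁻¹ ≤ (1 + v) / (1 + v') * (1 + t * v)⁻¹ := by
    rw [← div_eq_mul_inv, div_div, inv_eq_one_div, div_le_div_iff₀ (by nlinarith)
      (by nlinarith [mul_pos (hv.trans hvv) hv])]
    nlinarith
  calc _ ≤ (1 + v) / (1 + v') * (1 + t * v)⁻¹ * (1 + z) - z := by gcongr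
    _ ≤ (1 + v) / (1 + v') * ((1 + t * v)⁻¹ * (1 + z) - z) := by nlinarith
    _ ≤ _ := by gcongr

/-- Allows a passage to some `v' < v`, needed because the supremum defining the exponent may not be
attained. Taking `v' = c * v` with `c` near `1` costs an amount bounded uniformly in `d`. -/
lemma exists_dimFun_lt {η v D s : ℝ} (hη : 1 < η) (hv : 0 < v) (hD : D < s)
    (h : ∀ d : ℕ, dimFun η v (η ^ d) ≤ D) :
    ∃ v', 0 < v' ∧ v' < v ∧ ∀ d : ℕ, dimFun η v' (η ^ d) < s := by
  have hlim : Tendsto (fun c : ℝ => c⁻¹ * D + (c⁻¹ - 1) * (η - 1)⁻¹) (𝓝[<] 1) (𝓝 D) := by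
    have : ContinuousAt (fun c : ℝ => c⁻¹ * D + (c⁻¹ - 1) * (η - 1)⁻¹) 1 := by
      have : ContinuousAt (fun c : ℝ => c⁻¹) 1 := continuousAt_inv₀ one_ne_zero
      fun_prop
    have h2 := this.tendsto
    simp only [inv_one, one_mul, sub_self, zero_mul, add_zero] at h2
    exact h2.mono_left nhdsWithin_le_nhds
  obtain ⟨c, hc, hc0, hc1⟩ := ((hlim.eventually (gt_mem_nhds hD)).and
    ((Ioo_mem_nhdsLT (zero_lt_one (α := ℝ))))).exists
  refine ⟨c * v, by positivity, by nlinarith, fun d => lt_of_le_of_lt ?_ hc⟩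
  have ht : 1 ≤ η ^ d := one_le_pow₀ hη.le
  specialize h d
  rw [dimFun_eq_sub hη hv ht] at h
  rw [dimFun_eq_sub hη (by positivity) ht]
  set t := η ^ d
  have h2 : 0 < η * t - 1 := by nlinarith
  have hz1 : (η * t - 1)⁻¹ ≤ (η - 1)⁻¹ := by
    apply inv_anti₀ <;> nlinarith
  set z := (η * t - 1)⁻¹
  have hz : 0 < z := by positivity
  have hcinv : 1 < c⁻¹ := (one_lt_inv₀ hc0).2 hc1
  have h3 : (1 + t * (c * v))⁻¹ ≤ c⁻¹ * (1 + t * v)⁻¹ := by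
    rw [← mul_inv]
    apply inv_anti₀
    · positivity
    · nlinarith
  calc _ ≤ c⁻¹ * (1 + t * v)⁻¹ * (1 + z) - z := by gcongr
    _ = c⁻¹ * ((1 + t * v)⁻¹ * (1 + z) - z) + (c⁻¹ - 1) * z := by ring
    _ ≤ _ := by
      have : 0 ≤ c⁻¹ - 1 := by linarith
      gcongr

/-! ### The prescribed intervals in terms of `η ^ l * (η - v)`. -/

lemma two_lt_zpow_lZero {η : ℝ} (hη : 1 < η) : 2 < η ^ lZero η * (η - 1) := by
  have h0 : 0 < η := by linarith
  have hlog : 0 < Real.log η := Real.log_pos hη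
  have h1 : (Real.log 2 - Real.log (η - 1)) / Real.log η < (lZero η : ℝ) := by
    refine (Int.lt_floor_add_one _).trans_le ?_
    have : ⌊(Real.log 2 - Real.log (η - 1)) / Real.log η⌋ + 1 ≤ lZero η := le_max_right _ _
    exact_mod_cast this
  rw [div_lt_iff₀ hlog, ← Real.log_zpow, ← Real.log_div (by norm_num) (by linarith)] at h1
  have h2 := (Real.log_lt_log_iff (div_pos two_pos (by linarith)) (zpow_pos h0 _)).1 h1
  rwa [div_lt_iff₀ (by linarith)] at h2

/-- The level is unique: `η ^ l * (η - v) ≥ 2` makes the next product at least `2 * η`, which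
exceeds `η + 1`. -/
lemma lTilde_eq {η v : ℝ} {l : ℤ} (hη : 1 < η) (hl : 1 ≤ l) (h2 : 2 ≤ η ^ l * (η - v))
    (h3 : η ^ l * (η - v) ≤ η + 1) : lTilde η v = l := by
  have h0 : 0 < η := by linarith
  have hlog : 0 < Real.log η := Real.log_pos hη
  have hT : 0 < η ^ l := zpow_pos h0 l
  have hp : 0 < η - v := by
    by_contra hcon
    push Not at hcon
    nlinarith
  have : ⌊(Real.log (η + 1) - Real.log (η - v)) / Real.log η⌋ = l := by
    rw [Int.floor_eq_iff, le_div_iff₀ hlog, div_lt_iff₀ hlog]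
    constructor
    · rw [← Real.log_zpow]
      have := Real.log_le_log (by positivity) h3
      rw [Real.log_mul hT.ne' hp.ne'] at this
      linarith
    · have h4 : η + 1 < η ^ l * η * (η - v) := by nlinarith
      have := Real.log_lt_log (by linarith) h4
      rw [Real.log_mul (by positivity) hp.ne', Real.log_mul hT.ne' h0.ne', Real.log_zpow] at this
      linarith
  rw [lTilde, this, max_eq_right hl]

lemma lowerEnd_lt_iff {η v : ℝ} {l : ℤ} (hη : 1 < η) :
    lowerEnd η l < v ↔ η ^ l * (η - v) < η + 1 - (η ^ l)⁻¹ := by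
  have h0 : 0 < η := by linarith
  have hT : 0 < η ^ l := zpow_pos h0 l
  rw [lowerEnd, two_mul, zpow_add₀ h0.ne', zpow_add₀ h0.ne', zpow_one]
  set T := η ^ l
  rw [sub_lt_comm, lt_div_iff₀ (by positivity)]
  have : η + 1 - T⁻¹ = (T + T * η - 1) / T := by field_simp; ring
  rw [this, lt_div_iff₀ hT]
  constructor <;> intro h <;> linarith

lemma le_upperEnd_iff {η v : ℝ} {l : ℤ} (hη : 1 < η) :
    v ≤ upperEnd η l ↔ 2 ≤ η ^ l * (η - v) := by
  have h0 : 0 < η := by linarith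
  have hT : 0 < η ^ l := zpow_pos h0 l
  rw [upperEnd, le_sub_comm, div_le_iff₀ hT, mul_comm]

/-- The intervals say `2 ≤ η ^ l * (η - v) < η + 1 - (η ^ l)⁻¹`; only the weaker bound `η + 1` is
needed later. For `l > lZero η`, positivity of `v` follows since `η ^ l * (η - 1)` already exceeds
`2 * η`. -/
lemma exists_level_of_mem_exponentRange {η v : ℝ} (hη : 1 < η) (hv : v ∈ exponentRange η) :
    ∃ l : ℕ, 1 ≤ l ∧ lTilde η v = l ∧ 0 < v ∧ 2 ≤ η ^ l * (η - v) ∧ η ^ l * (η - v) ≤ η + 1 := by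
  have h0 : 0 < η := by linarith
  suffices ∃ l : ℤ, 1 ≤ l ∧ 0 < v ∧ 2 ≤ η ^ l * (η - v) ∧ η ^ l * (η - v) ≤ η + 1 by
    obtain ⟨l, hl, hv0, h2, h3⟩ := this
    lift l to ℕ using by omega
    exact ⟨l, by omega, lTilde_eq hη hl h2 h3, hv0, by simpa using h2, by simpa using h3⟩
  have hl0 : 1 ≤ lZero η := le_max_left _ _
  have hz := two_lt_zpow_lZero hη
  rcases hv with hv | hv
  · obtain ⟨hv1, hv2⟩ := hv
    rw [max_lt_iff, lowerEnd_lt_iff hη] at hv1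
    have := inv_pos.2 (zpow_pos h0 (lZero η))
    exact ⟨lZero η, hl0, by linarith, (le_upperEnd_iff hη).1 hv2, by linarith⟩
  · simp only [mem_iUnion] at hv
    obtain ⟨l, hl, hv1, hv2⟩ := hv
    rw [lowerEnd_lt_iff hη] at hv1
    have hT : 0 < η ^ l := zpow_pos h0 l
    have := inv_pos.2 hT
    refine ⟨l, by omega, ?_, (le_upperEnd_iff hη).1 hv2, by linarith⟩
    have h4 : η ^ lZero η * η ≤ η ^ l := by
      rw [← zpow_add_one₀ h0.ne']
      exact zpow_le_zpow_right₀ hη.le hl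
    by_contra hcon
    push Not at hcon
    have h5 : 2 * η < η ^ l * (η - 1) := by nlinarith
    have h6 : η ^ l * (η - 1) ≤ η ^ l * (η - v) := by
      apply mul_le_mul_of_nonneg_left _ hT.le; linarith
    linarith

lemma dimValue_eq_dimFun {η v : ℝ} {l : ℕ} (hη : 1 < η) (h : lTilde η v = l) :
    dimValue η v = dimFun η v (η ^ l) := by
  have h0 : 0 < η := by linarith
  rw [dimValue, dimFun, h, zpow_add_one₀ h0.ne', zpow_natCast, mul_comm η]

lemma upperEnd_mem_exponentRange {η : ℝ} {l : ℤ} (hη : 1 < η) (hl : lZero η ≤ l) :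
    upperEnd η l ∈ exponentRange η := by
  have h0 : 0 < η := by linarith
  have hz := two_lt_zpow_lZero hη
  have hT : 0 < η ^ l := zpow_pos h0 l
  have hT1 : η ^ lZero η ≤ η ^ l := zpow_le_zpow_right₀ hη.le hl
  have h5 : 2 < η ^ l * (η - 1) := by nlinarith
  have hlow : lowerEnd η l < upperEnd η l := by
    rw [lowerEnd_lt_iff hη]
    have : η ^ l * (η - upperEnd η l) = 2 := by rw [upperEnd]; field_simp; ring
    have : (η ^ l)⁻¹ < η - 1 := by
      rw [inv_lt_iff_one_lt_mul₀ hT]; linarith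
    linarith
  rcases hl.eq_or_lt with rfl | hl
  · refine Or.inl ⟨max_lt ?_ hlow, le_rfl⟩
    rw [upperEnd, lt_sub_comm, div_lt_iff₀ hT]
    linarith
  · exact Or.inr (mem_iUnion₂.2 ⟨l, hl, hlow, le_rfl⟩)

/-- Here `η ^ l * (η - v) = 2`, so the numerator is `1` and the denominator is the square `(η ^ l *
η - 1) ^ 2`. -/
lemma dimValue_upperEnd {η : ℝ} {l : ℤ} (hη : 1 < η) (hl : lZero η ≤ l) :
    dimValue η (upperEnd η l) = ((η - upperEnd η l) / (η + upperEnd η l)) ^ 2 := by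
  have h0 : 0 < η := by linarith
  have hl1 : 1 ≤ l := (le_max_left _ _).trans hl
  have hT : 0 < η ^ l := zpow_pos h0 l
  have e : η ^ l * (η - upperEnd η l) = 2 := by rw [upperEnd]; field_simp; ring
  rw [dimValue, lTilde_eq hη hl1 (by linarith) (by linarith), zpow_add_one₀ h0.ne']
  have hT1 : 1 < η ^ l := one_lt_zpow₀ hη (by omega)
  have hu : η ^ l * upperEnd η l = η ^ l * η - 2 := by linarith
  have hd : η ^ l * η - 1 ≠ 0 := by nlinarith
  rw [hu, upperEnd]
  set T := η ^ l
  have h7 : η + (η - 2 / T) = 2 * (T * η - 1) / T := by field_simp; ring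
  rw [h7]
  have h8 : 1 + (T * η - 2) = T * η - 1 := by ring
  rw [h8]
  field_simp
  ring

/-! ### Termination of the gap dynamics. -/

/-- `Doomed η s Q S` says that, starting from the state `S`, every sequence of moves
`S ↦ 1 + S / η ^ d` respecting the constraint `S + s * η ^ d ≤ Q` terminates. -/
inductive Doomed (η s Q : ℝ) : ℝ → Prop
  | mk (S : ℝ) (h : ∀ d : ℕ, 1 ≤ d → S + s * η ^ d ≤ Q → Doomed η s Q (1 + S / η ^ d)) :
    Doomed η s Q S

lemma Doomed.mono {η s Q S S' : ℝ} (hη : 1 < η) (h : Doomed η s Q S) (hS : S ≤ S') :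
    Doomed η s Q S' := by
  induction h generalizing S' with
  | mk S h ih =>
    refine .mk _ fun d hd hd' => ih d hd (by linarith) ?_
    have : 0 < η ^ d := by positivity
    gcongr

/-- If no constant sequence of moves is admissible at its fixed point, every state is doomed. -/
lemma doomed_of_forall {η s Q S : ℝ} (hη : 1 < η) (hs : 0 < s)
    (h : ∀ d : ℕ, 1 ≤ d → Q < η ^ d / (η ^ d - 1) + s * η ^ d) (hS : 0 ≤ S) :
    Doomed η s Q S := by
  -- Induction on the largest move still admissible: the hypothesis on `S` rules out all `d ≥ D +
  -- 1`.
  have main : ∀ D : ℕ, ∀ S, 0 ≤ S → Q < S + s * η ^ (D + 1) → Doomed η s Q S := by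
    intro D
    induction D with
    | zero =>
      intro S hS hQ
      refine .mk _ fun d hd hd' => absurd hd' (not_le.2 (hQ.trans_le ?_))
      have : η ^ (0 + 1) ≤ η ^ d := pow_le_pow_right₀ hη.le hd
      gcongr
    | succ D ih =>
      intro S hS hQ
      have hu : 1 < η ^ (D + 1) := one_lt_pow₀ hη (by omega)
      have hfix := h (D + 1) (by omega)
      set u := η ^ (D + 1) with hudef
      set σ := u / (u - 1) with hσ
      have hσu : σ * (u - 1) = u := by rw [hσ]; field_simp [(by linarith : u - 1 ≠ 0)]
      -- `σ` is the fixed point of `S ↦ 1 + S / u`. Every move with `d ≤ D + 1` brings the state at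
      -- least as close to `σ` as this contraction does, so after `j` moves even `d = D + 1` is
      -- inadmissible.
      have inner : ∀ j : ℕ, ∀ S, 0 ≤ S → Q < S + s * η ^ (D + 1 + 1) →
          Q < σ - (σ - S) / u ^ j + s * u → Doomed η s Q S := by
        intro j
        induction j with
        | zero =>
          intro S hS _ h2
          exact ih S hS (by simpa using h2)
        | succ j ihj =>
          intro S hS h1 h2
          by_cases h3 : Q < S + s * u
          · exact ih S hS h3
          push Not at h3
          have h4 : S < σ := by linarith
          have h5 : S < 1 + S / u := by
            have : 1 + S / u = (u + S) / u := by field_simp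
            rw [this, lt_div_iff₀ (by linarith)]
            nlinarith
          refine .mk _ fun d hd hd' => ?_
          have hdD : d ≤ D + 1 := by
            by_contra hcon
            have : η ^ (D + 1 + 1) ≤ η ^ d := pow_le_pow_right₀ hη.le (by omega)
            nlinarith
          have hdu : η ^ d ≤ u := pow_le_pow_right₀ hη.le hdD
          have hd0 : 0 < η ^ d := by positivity
          refine (ihj (1 + S / u) (by positivity) (by linarith) ?_).mono hη ?_
          · have : (σ - (1 + S / u)) / u ^ j = (σ - S) / u ^ (j + 1) := by
              rw [pow_succ]
              have : σ - (1 + S / u) = (σ - S) / u := by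
                field_simp
                linarith
              rw [this, div_div, mul_comm]
            rwa [this]
          · gcongr
      have hlim : Tendsto (fun j : ℕ => σ - (σ - S) / u ^ j + s * u) atTop
          (𝓝 (σ - 0 + s * u)) := by
        refine (tendsto_const_nhds.sub ?_).add tendsto_const_nhds
        exact tendsto_const_nhds.div_atTop (tendsto_pow_atTop_atTop_of_one_lt hu)
      rw [sub_zero] at hlim
      obtain ⟨j, hj⟩ := (hlim.eventually (lt_mem_nhds hfix)).exists
      exact inner j S hS hQ hj
  have hlim : Tendsto (fun D : ℕ => S + s * η ^ (D + 1)) atTop atTop := by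
    refine tendsto_atTop_add_const_left _ _ (Tendsto.const_mul_atTop hs ?_)
    exact (tendsto_pow_atTop_atTop_of_one_lt hη).comp (tendsto_add_atTop_nat 1)
  obtain ⟨D, hD⟩ := (hlim.eventually (eventually_gt_atTop Q)).exists
  exact main D S hS hD

/-- The condition at the fixed point for gap `d + 1`, cleared of denominators, is exactly `dimFun η
v (η ^ d) < s`. -/
lemma doomed_of_dimFun_lt {η s v S : ℝ} (hη : 1 < η) (hv : 0 < v) (hs : 0 < s)
    (h : ∀ d : ℕ, dimFun η v (η ^ d) < s) (hS : 0 ≤ S) :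
    Doomed η s ((1 - s) * η / v) S := by
  refine doomed_of_forall hη hs (fun d hd => ?_) hS
  obtain ⟨d, rfl⟩ := Nat.exists_eq_add_of_le' hd
  specialize h d
  have ht : 1 ≤ η ^ d := one_le_pow₀ hη.le
  rw [pow_succ]
  unfold dimFun at h
  set t := η ^ d
  have h1 : 0 < η * t - 1 := by nlinarith
  have h2 : 0 < 1 + t * v := by positivity
  rw [div_lt_iff₀ (by positivity)] at h
  have h3 : t * η / (t * η - 1) + s * (t * η) = (t * η + s * (t * η) * (η * t - 1)) / (η * t - 1) := by
    rw [mul_comm t η]; field_simp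
  rw [h3, div_lt_div_iff₀ hv h1]
  nlinarith

/-! ### Pre-measures and asymptotics of the sequence. -/

open MeasureTheory in
/-- The size-`r` Hausdorff pre-measure of dimension `s` on the line. -/
noncomputable def preHausdorff (s : ℝ) (r : ENNReal) : OuterMeasure ℝ :=
  OuterMeasure.mkMetric'.pre (fun A : Set ℝ => Metric.ediam A ^ s) r

lemma preHausdorff_le {s : ℝ} (hs : 0 ≤ s) {r : ENNReal} {c ρ : ℝ} {A : Set ℝ} (hρ : 0 ≤ ρ)
    (hr : ENNReal.ofReal (2 * ρ) ≤ r) (hA : A ⊆ Icc (c - ρ) (c + ρ)) :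
    preHausdorff s r A ≤ ENNReal.ofReal ((2 * ρ) ^ s) := by
  have hd : Metric.ediam A ≤ ENNReal.ofReal (2 * ρ) := by
    refine (Metric.ediam_mono hA).trans ?_
    rw [Real.ediam_Icc]
    apply ENNReal.ofReal_le_ofReal
    linarith
  refine (MeasureTheory.OuterMeasure.mkMetric'.pre_le (hd.trans hr)).trans ?_
  rw [← ENNReal.ofReal_rpow_of_nonneg (by linarith) hs]
  gcongr

open MeasureTheory in
lemma hausdorffMeasure_eq_zero_of_preHausdorff {s : ℝ} {A : Set ℝ}
    (h : ∀ r > 0, preHausdorff s r A = 0) : Measure.hausdorffMeasure s A = 0 := by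
  rw [Measure.hausdorffMeasure, ← OuterMeasure.coe_mkMetric]
  simp only [OuterMeasure.mkMetric, OuterMeasure.mkMetric', OuterMeasure.iSup_apply]
  simp only [ENNReal.iSup_eq_zero]
  intro r hr
  exact h r hr

lemma tendsto_ratio_add {a : ℕ → ℕ} (ha : StrictMono a) (ha0 : 0 < a 0) {η : ℝ}
    (hlim : Tendsto (fun n : ℕ => (a (n + 1) : ℝ) / (a n : ℝ)) atTop (𝓝 η)) (d : ℕ) :
    Tendsto (fun n : ℕ => (a (n + d) : ℝ) / (a n : ℝ)) atTop (𝓝 (η ^ d)) := by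
  have hpos : ∀ n, (0 : ℝ) < a n := fun n => by
    exact_mod_cast ha0.trans_le (ha.monotone (Nat.zero_le n))
  induction d with
  | zero =>
    simp only [add_zero, pow_zero]
    exact tendsto_const_nhds.congr fun n => (div_self (hpos n).ne').symm
  | succ d ih =>
    rw [pow_succ']
    refine ((hlim.comp (tendsto_add_atTop_nat d)).mul ih).congr fun n => ?_
    have := (hpos n).ne'
    have := (hpos (n + d)).ne'
    simp only [Function.comp, ← add_assoc]
    field_simp

lemma tendsto_cast_atTop_of_strictMono {a : ℕ → ℕ} (ha : StrictMono a) :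
    Tendsto (fun n => (a n : ℝ)) atTop atTop :=
  tendsto_natCast_atTop_atTop.comp ha.tendsto_atTop

/-- Any loss in the exponent that is strict in the limit absorbs both constants and the `o(a n)`
errors. -/
lemma eventually_const_mul_rpow_le {β : ℝ} (hβ : 1 < β) {a e : ℕ → ℝ}
    (ha : Tendsto a atTop atTop) {E E' : ℝ} (he : Tendsto (fun n => e n / a n) atTop (𝓝 E))
    (hE : E < E') (C : ℝ) : ∀ᶠ n in atTop, C * β ^ e n ≤ β ^ (E' * a n) := by
  have h1 := he.eventually (gt_mem_nhds (show E < (E + E') / 2 by linarith))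
  have h2 : Tendsto (fun n => β ^ ((E' - E) / 2 * a n)) atTop atTop := by
    have := ha.const_mul_atTop (show 0 < (E' - E) / 2 by linarith)
    exact (tendsto_rpow_atTop_of_base_gt_one β hβ).comp this
  filter_upwards [h1, h2.eventually (eventually_ge_atTop C), ha.eventually (eventually_gt_atTop 0)]
    with n h1 h2 h3
  rw [div_lt_iff₀ h3] at h1
  calc C * β ^ e n ≤ β ^ ((E' - E) / 2 * a n) * β ^ ((E + E') / 2 * a n) := by
        have := Real.rpow_pos_of_pos (zero_lt_one.trans hβ) (e n)
        gcongr
        exact hβ.le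
    _ = β ^ (E' * a n) := by
        rw [← Real.rpow_add (by linarith)]
        ring_nf

/-! ### Records and the covers they provide. -/

/-- `n` is a strict record minimum of `f`. -/
def IsRecord (f : ℕ → ℝ) (n : ℕ) : Prop := ∀ m < n, f n < f m

/-- The numbers approximated with exponent `v` from the index `N₀` on, without exact hits. -/
def approxSet (b : ℕ) (a : ℕ → ℕ) (v : ℝ) (N₀ : ℕ) : Set ℝ :=
  {ξ : ℝ | (∀ N, N₀ ≤ N → ∃ n, n ≤ N ∧
    distNearestInt ((b : ℝ) ^ (a n) * ξ) < ((b : ℝ) ^ (a N)) ^ (-v)) ∧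
    ∀ n, 0 < distNearestInt ((b : ℝ) ^ (a n) * ξ)}

/-- The members of `approxSet` with record index `n` and nearest integer `p` at that index. -/
def recordSet (b : ℕ) (a : ℕ → ℕ) (v : ℝ) (N₀ n : ℕ) (p : ℤ) : Set ℝ :=
  {ξ : ℝ | ξ ∈ approxSet b a v N₀ ∧ IsRecord (fun n => distNearestInt ((b : ℝ) ^ (a n) * ξ)) n ∧
    round ((b : ℝ) ^ (a n) * ξ) = p}

lemma pow_rpow_neg {b : ℕ} (k : ℕ) (v : ℝ) :
    ((b : ℝ) ^ k) ^ (-v) = (b : ℝ) ^ (-(v * k)) := by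
  rw [← Real.rpow_natCast, ← Real.rpow_mul (by positivity)]
  ring_nf

/-- `n + d` is the first index with a smaller value, so at time `n + d - 1` the minimum is still
attained at `n`. -/
lemma exists_next_record {b : ℕ} (hb : 2 ≤ b) {a : ℕ → ℕ} (ha : StrictMono a) {v : ℝ} (hv : 0 < v)
    {N₀ n : ℕ} {ξ : ℝ} (hξ : ξ ∈ approxSet b a v N₀)
    (hn : IsRecord (fun n => distNearestInt ((b : ℝ) ^ (a n) * ξ)) n) :
    ∃ d, 1 ≤ d ∧ IsRecord (fun n => distNearestInt ((b : ℝ) ^ (a n) * ξ)) (n + d) ∧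
      (N₀ ≤ n → distNearestInt ((b : ℝ) ^ (a n) * ξ) < (b : ℝ) ^ (-(v * a (n + d - 1)))) := by
  obtain ⟨h1, h2⟩ := hξ
  set f := fun n => distNearestInt ((b : ℝ) ^ (a n) * ξ) with hf
  have hb1 : (1 : ℝ) < b := by exact_mod_cast hb
  have hex : ∃ n', f n' < f n := by
    have h3 : Tendsto (fun N => (b : ℝ) ^ (-(v * a N))) atTop (𝓝 0) := by
      refine (tendsto_rpow_atBot_of_base_gt_one _ hb1).comp (tendsto_neg_atTop_atBot.comp ?_)
      exact (tendsto_cast_atTop_of_strictMono ha).const_mul_atTop hv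
    obtain ⟨N, hN, hN'⟩ := ((h3.eventually (gt_mem_nhds (h2 n))).and
      (eventually_ge_atTop N₀)).exists
    obtain ⟨m, _, hm⟩ := h1 N hN'
    rw [pow_rpow_neg] at hm
    exact ⟨m, hm.trans hN⟩
  classical
  have hmin : ∀ m < Nat.find hex, f n ≤ f m := fun m hm => not_lt.1 (Nat.find_min hex hm)
  have hsp := Nat.find_spec hex
  have hlt : n < Nat.find hex := by
    by_contra hcon
    rcases (not_lt.1 hcon).eq_or_lt with h | h
    · rw [h] at hsp; exact lt_irrefl _ hsp
    · exact lt_asymm hsp (hn _ h)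
  refine ⟨Nat.find hex - n, by omega, ?_, fun hN => ?_⟩
  · rw [Nat.add_sub_cancel' hlt.le]
    exact fun m hm => hsp.trans_le (hmin m hm)
  · rw [Nat.add_sub_cancel' hlt.le]
    obtain ⟨m, hm, hm'⟩ := h1 (Nat.find hex - 1) (by omega)
    rw [pow_rpow_neg] at hm'
    exact (hmin m (by omega)).trans_lt hm'

/-- A record index where the approximation carries over without cancellation is impossible. -/
lemma not_lt_of_small {K : ℕ} (hK : 1 ≤ K) {y : ℝ} (h : K * distNearestInt y < 1 / 2) :
    ¬ distNearestInt (K * y) < distNearestInt y := by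
  intro hlt
  unfold distNearestInt at *
  have hK' : (1 : ℝ) ≤ K := by exact_mod_cast hK
  have h0 := abs_nonneg (y - round y)
  have h1 : |(K : ℝ) * y - K * round y| = K * |y - round y| := by
    rw [← mul_sub, abs_mul, abs_of_nonneg (by positivity : (0 : ℝ) ≤ K)]
  by_cases he : round ((K : ℝ) * y) = K * round y
  · rw [he] at hlt
    push_cast at hlt
    rw [h1] at hlt
    nlinarith
  · have h2 : (1 : ℤ) ≤ |round ((K : ℝ) * y) - K * round y| :=
      Int.one_le_abs (sub_ne_zero.2 he)
    have h3 : (1 : ℝ) ≤ |(round ((K : ℝ) * y) : ℝ) - K * round y| := by exact_mod_cast h2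
    have h4 : |(round ((K : ℝ) * y) : ℝ) - K * round y|
        ≤ |(K : ℝ) * y - round ((K : ℝ) * y)| + |(K : ℝ) * y - K * round y| := by
      have := abs_sub_le (round ((K : ℝ) * y) : ℝ) (K * y) (K * round y)
      rwa [abs_sub_comm (round ((K : ℝ) * y) : ℝ) (K * y)] at this
    nlinarith

/-- The part of `recordSet` with a good approximation at `n` lies in a short interval. -/
lemma recordSet_inter_subset_Icc {b : ℕ} (hb : 2 ≤ b) {a : ℕ → ℕ} {v : ℝ} {N₀ n : ℕ} {p : ℤ}
    (L : ℝ) :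
    {ξ ∈ recordSet b a v N₀ n p | distNearestInt ((b : ℝ) ^ (a n) * ξ) < (b : ℝ) ^ L} ⊆
      Icc (p / (b : ℝ) ^ a n - (b : ℝ) ^ (L - a n)) (p / (b : ℝ) ^ a n + (b : ℝ) ^ (L - a n)) := by
  rintro ξ ⟨⟨_, _, hp⟩, h⟩
  have hb0 : (0 : ℝ) < b := by positivity
  have hpow : (0 : ℝ) < (b : ℝ) ^ a n := by positivity
  rw [distNearestInt, hp, abs_lt] at h
  rw [Real.rpow_sub hb0, Real.rpow_natCast, ← sub_div, ← add_div, mem_Icc, div_le_iff₀ hpow,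
    le_div_iff₀ hpow]
  constructor <;> linarith [h.1, h.2]

/-- Covering the continuation of a record by the possible nearest integers at the next record. -/
lemma measure_next_record_le {b : ℕ} (hb : 2 ≤ b) {a : ℕ → ℕ} (ha : StrictMono a) {v : ℝ}
    {N₀ n d : ℕ} (hd : 1 ≤ d) {p : ℤ} (μ : MeasureTheory.OuterMeasure ℝ) {L w : ℝ} (hw : 0 ≤ w)
    (hμ : ∀ p', μ (recordSet b a v N₀ (n + d) p') ≤ ENNReal.ofReal w) :
    μ {ξ ∈ recordSet b a v N₀ n p | distNearestInt ((b : ℝ) ^ (a n) * ξ) < (b : ℝ) ^ L ∧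
      IsRecord (fun n => distNearestInt ((b : ℝ) ^ (a n) * ξ)) (n + d)}
      ≤ ENNReal.ofReal (6 * ((b : ℝ) ^ (L + a (n + d) - a n)) * w) := by
  have hb0 : (0 : ℝ) < b := by positivity
  have hlt : a n < a (n + d) := ha (by omega)
  set K : ℕ := b ^ (a (n + d) - a n) with hK
  have hK1 : 1 ≤ K := Nat.one_le_pow _ _ (by omega)
  have hKa : (b : ℝ) ^ a (n + d) = K * (b : ℝ) ^ a n := by
    rw [hK]; push_cast; rw [← pow_add, Nat.sub_add_cancel hlt.le]
  have hM : (b : ℝ) ^ (L + a (n + d) - a n) = K * (b : ℝ) ^ L := by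
    rw [Real.rpow_sub hb0, Real.rpow_add hb0, Real.rpow_natCast, Real.rpow_natCast, hKa]
    field_simp
  have hKpos : (0 : ℝ) < K := by exact_mod_cast hK1
  rw [hM]
  set M := K * (b : ℝ) ^ L with hMdef
  set A := {ξ ∈ recordSet b a v N₀ n p | distNearestInt ((b : ℝ) ^ (a n) * ξ) < (b : ℝ) ^ L ∧
      IsRecord (fun n => distNearestInt ((b : ℝ) ^ (a n) * ξ)) (n + d)} with hA
  rcases lt_or_ge M (1 / 2) with hM2 | hM2
  -- A crude count of next integers is about `2 * M + 2`, which is at most `6 * M` only if `M ≥ 1 /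
  -- 2`. For smaller `M` multiplication by `K` cannot create a smaller distance, so no record
  -- occurs.
  · have : A = ∅ := by
      refine eq_empty_of_forall_notMem ?_
      rintro ξ ⟨_, h1, h2⟩
      have h3 := h2 n (by omega)
      simp only [hKa, mul_assoc] at h3
      refine not_lt_of_small hK1 (lt_trans ?_ hM2) h3
      rw [hMdef]
      gcongr
    rw [this]
    simp
  · set F := Finset.Icc ⌈(K * p - M - 1 / 2 : ℝ)⌉ ⌊(K * p + M + 1 / 2 : ℝ)⌋ with hF
    have hsub : A ⊆ ⋃ p' ∈ F, recordSet b a v N₀ (n + d) p' := by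
      rintro ξ ⟨⟨h0, _, hp⟩, h1, h2⟩
      refine mem_iUnion₂.2 ⟨round ((b : ℝ) ^ a (n + d) * ξ), ?_, h0, h2, rfl⟩
      rw [hF, Finset.mem_Icc, Int.ceil_le, Int.le_floor]
      have h3 := abs_sub_round ((b : ℝ) ^ a (n + d) * ξ)
      rw [distNearestInt, hp] at h1
      have h4 : |(b : ℝ) ^ a (n + d) * ξ - K * p| < M := by
        rw [hKa, mul_assoc, ← mul_sub, abs_mul, abs_of_pos hKpos, hMdef]
        gcongr
      rw [abs_lt] at h4
      rw [abs_le] at h3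
      constructor <;> linarith [h3.1, h3.2, h4.1, h4.2]
    have hcard : (F.card : ℝ) ≤ 6 * M := by
      have hle : ⌈(K * p - M - 1 / 2 : ℝ)⌉ ≤ ⌊(K * p + M + 1 / 2 : ℝ)⌋ + 1 := by
        rw [Int.ceil_le]
        push_cast
        have := Int.lt_floor_add_one (K * p + M + 1 / 2 : ℝ)
        linarith
      rw [hF, Int.card_Icc]
      have h5 : (((⌊(K * p + M + 1 / 2 : ℝ)⌋ + 1 - ⌈(K * p - M - 1 / 2 : ℝ)⌉).toNat : ℤ) : ℝ)
          = ((⌊(K * p + M + 1 / 2 : ℝ)⌋ + 1 - ⌈(K * p - M - 1 / 2 : ℝ)⌉ : ℤ) : ℝ) := by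
        rw [Int.toNat_of_nonneg (by omega)]
      rw [Int.cast_natCast] at h5
      rw [h5]
      push_cast
      have := Int.floor_le (K * p + M + 1 / 2 : ℝ)
      have := Int.le_ceil (K * p - M - 1 / 2 : ℝ)
      linarith
    calc μ A ≤ ∑ p' ∈ F, μ (recordSet b a v N₀ (n + d) p') :=
          (MeasureTheory.measure_mono hsub).trans (MeasureTheory.measure_biUnion_finset_le _ _)
      _ ≤ ∑ p' ∈ F, ENNReal.ofReal w := Finset.sum_le_sum fun p' _ => hμ p'
      _ = ENNReal.ofReal (F.card * w) := by
          rw [Finset.sum_const, nsmul_eq_mul, ENNReal.ofReal_mul (by positivity),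
            ENNReal.ofReal_natCast]
      _ ≤ _ := by gcongr

lemma exists_pos_forall_mem_finset {ι : Type*} (F : Finset ι) {P : ι → ℝ → Prop}
    (hP : ∀ i δ δ', δ' ≤ δ → P i δ → P i δ') (h : ∀ i ∈ F, ∃ δ > 0, P i δ) :
    ∃ δ > 0, ∀ i ∈ F, P i δ := by
  classical
  induction F using Finset.induction_on with
  | empty => exact ⟨1, one_pos, by simp⟩
  | insert i F hi ih =>
    obtain ⟨δ, hδ, h1⟩ := ih fun j hj => h j (Finset.mem_insert_of_mem hj)
    obtain ⟨δ', hδ', h2⟩ := h i (Finset.mem_insert_self _ _)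
    refine ⟨min δ δ', lt_min hδ hδ', fun j hj => ?_⟩
    rcases Finset.mem_insert.1 hj with rfl | hj
    · exact hP _ _ _ (min_le_right _ _) h2
    · exact hP _ _ _ (min_le_left _ _) (h1 j hj)

/-! ### Exponential gain along the records. -/

section Cover

variable {b : ℕ} {a : ℕ → ℕ} {η v s S : ℝ}

lemma tendsto_div_self_mul (ha : StrictMono a) (ha0 : 0 < a 0) (c : ℝ) :
    Tendsto (fun n => c * (a n : ℝ) / a n) atTop (𝓝 c) := by
  refine tendsto_const_nhds.congr fun n => ?_
  have : (0 : ℝ) < a n := by exact_mod_cast ha0.trans_le (ha.monotone (Nat.zero_le n))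
  field_simp

/-- One interval of length about `b ^ (-(1 + v * η ^ (d - 1)) * a n)` suffices: the hypothesis `h`
says that its `s`-th power beats the target exponent. -/
lemma exists_preHausdorff_short_le (hb : 2 ≤ b) (ha : StrictMono a) (ha0 : 0 < a 0) (hη : 1 < η)
    (hlim : Tendsto (fun n : ℕ => (a (n + 1) : ℝ) / (a n : ℝ)) atTop (𝓝 η))
    (hv : 0 < v) (hs : 0 < s) (N₀ : ℕ) {r : ENNReal} (hr : 0 < r) {d : ℕ} (hd : 1 ≤ d)
    (h : (1 - s) * η / v < S + s * η ^ d) :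
    ∃ δ > 0, ∀ᶠ n in atTop, ∀ p : ℤ,
      preHausdorff s r {ξ ∈ recordSet b a v N₀ n p |
        distNearestInt ((b : ℝ) ^ (a n) * ξ) < (b : ℝ) ^ (-(v * a (n + d - 1)))} ≤
      ENNReal.ofReal ((b : ℝ) ^ (-((1 - v / η * S + δ) * a n))) := by
  have hb1 : (1 : ℝ) < b := by exact_mod_cast hb
  obtain ⟨d, rfl⟩ := Nat.exists_eq_add_of_le' hd
  simp only [← add_assoc, Nat.add_sub_cancel]
  have haT := tendsto_cast_atTop_of_strictMono ha
  have hpos : ∀ n, (0 : ℝ) < a n := fun n => by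
    exact_mod_cast ha0.trans_le (ha.monotone (Nat.zero_le n))
  have he : Tendsto (fun n => (-(v * a (n + d)) - a n : ℝ) / a n) atTop
      (𝓝 (-(v * η ^ d) - 1)) := by
    refine (((tendsto_ratio_add ha ha0 hlim d).const_mul v).neg.sub_const 1).congr fun n => ?_
    have := (hpos n).ne'
    field_simp
  have he2 : Tendsto (fun n => (s * (-(v * a (n + d)) - a n) : ℝ) / a n) atTop
      (𝓝 (s * (-(v * η ^ d) - 1))) := (he.const_mul s).congr fun n => by ring
  have hkey : 1 - v / η * S < s * (1 + v * η ^ d) := by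
    have h0 : 0 < η := by linarith
    rw [div_lt_iff₀ hv, pow_succ] at h
    have : (1 - s) * η < (S * v / η + s * η ^ d * v) * η := by
      have e : (S * v / η + s * η ^ d * v) * η = (S + s * (η ^ d * η)) * v := by field_simp
      rwa [e]
    have := lt_of_mul_lt_mul_right this h0.le
    have e2 : v / η * S = S * v / η := by ring
    rw [e2]
    linarith
  set δ := (s * (1 + v * η ^ d) - (1 - v / η * S)) / 2 with hδ
  have hδ0 : 0 < δ := by rw [hδ]; linarith
  refine ⟨δ, hδ0, ?_⟩
  have hvd : 0 < v * η ^ d := by positivity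
  have hsmall : ∀ᶠ n in atTop, ENNReal.ofReal (2 * (b : ℝ) ^ (-(v * a (n + d)) - a n : ℝ)) ≤ r := by
    have h1 : Tendsto (fun n => ENNReal.ofReal ((b : ℝ) ^ (-1 * (a n : ℝ)))) atTop (𝓝 0) := by
      rw [← ENNReal.ofReal_zero]
      refine ENNReal.tendsto_ofReal ((tendsto_rpow_atBot_of_base_gt_one _ hb1).comp ?_)
      exact haT.const_mul_atTop_of_neg (by norm_num)
    filter_upwards [h1.eventually (gt_mem_nhds hr), eventually_const_mul_rpow_le hb1 haT he
      (show _ < (-1 : ℝ) by linarith) 2] with n h1 h2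
    exact (ENNReal.ofReal_le_ofReal h2).trans h1.le
  filter_upwards [hsmall, eventually_const_mul_rpow_le hb1 haT he2
      (show _ < -(1 - v / η * S + δ) by rw [hδ]; linarith) (2 ^ s)] with n h1 h2 p
  refine (preHausdorff_le hs.le (by positivity) h1 (recordSet_inter_subset_Icc hb _)).trans ?_
  apply ENNReal.ofReal_le_ofReal
  rw [Real.mul_rpow (by norm_num) (by positivity), ← Real.rpow_mul (by positivity), mul_comm _ s]
  rwa [neg_mul] at h2

/-- The number of possible next integers exactly balances the change of state from `S` to `1 + S / η
^ d`; the gain `δ` is not lost because `η ^ d > 1`. -/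
lemma exists_preHausdorff_next_le (hb : 2 ≤ b) (ha : StrictMono a) (ha0 : 0 < a 0) (hη : 1 < η)
    (hlim : Tendsto (fun n : ℕ => (a (n + 1) : ℝ) / (a n : ℝ)) atTop (𝓝 η)) (N₀ : ℕ)
    {r : ENNReal} {d : ℕ} (hd : 1 ≤ d)
    (h : ∃ δ > 0, ∀ᶠ n in atTop, ∀ p : ℤ, preHausdorff s r (recordSet b a v N₀ n p) ≤
      ENNReal.ofReal ((b : ℝ) ^ (-((1 - v / η * (1 + S / η ^ d) + δ) * a n)))) :
    ∃ δ > 0, ∀ᶠ n in atTop, ∀ p : ℤ,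
      preHausdorff s r {ξ ∈ recordSet b a v N₀ n p |
        distNearestInt ((b : ℝ) ^ (a n) * ξ) < (b : ℝ) ^ (-(v * a (n + d - 1))) ∧
        IsRecord (fun n => distNearestInt ((b : ℝ) ^ (a n) * ξ)) (n + d)} ≤
      ENNReal.ofReal ((b : ℝ) ^ (-((1 - v / η * S + δ) * a n))) := by
  have hb1 : (1 : ℝ) < b := by exact_mod_cast hb
  have haT := tendsto_cast_atTop_of_strictMono ha
  have hpos : ∀ n, (0 : ℝ) < a n := fun n => by
    exact_mod_cast ha0.trans_le (ha.monotone (Nat.zero_le n))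
  obtain ⟨δ, hδ, h⟩ := h
  refine ⟨δ, hδ, ?_⟩
  set E := 1 - v / η * (1 + S / η ^ d) + δ with hE
  have hlim1 : Tendsto (fun n => (a (n + d - 1) : ℝ) / a n) atTop (𝓝 (η ^ (d - 1))) := by
    refine (tendsto_ratio_add ha ha0 hlim (d - 1)).congr fun n => ?_
    rw [Nat.add_sub_assoc hd]
  have he : Tendsto (fun n => (-(v * a (n + d - 1)) + a (n + d) - a n + -(E * a (n + d)) : ℝ) / a n)
      atTop (𝓝 (-(v * η ^ (d - 1)) + η ^ d - 1 + -(E * η ^ d))) := by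
    have h2 := tendsto_ratio_add ha ha0 hlim d
    refine ((((hlim1.const_mul v).neg.add h2).sub_const 1).add (h2.const_mul E).neg).congr
      fun n => ?_
    have := (hpos n).ne'
    field_simp
  have hlt : -(v * η ^ (d - 1)) + η ^ d - 1 + -(E * η ^ d) < -(1 - v / η * S + δ) := by
    have h0 : 0 < η := by linarith
    obtain ⟨d, rfl⟩ := Nat.exists_eq_add_of_le' hd
    rw [Nat.add_sub_cancel]
    have hu : 1 < η ^ (d + 1) := one_lt_pow₀ hη (by omega)
    have e : E * η ^ (d + 1) = η ^ (d + 1) - v * η ^ d - v / η * S + δ * η ^ (d + 1) := by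
      rw [hE]; field_simp; ring
    rw [e]
    nlinarith
  filter_upwards [(tendsto_add_atTop_nat d).eventually h,
    eventually_const_mul_rpow_le hb1 haT he hlt 6] with n h1 h2 p
  refine (measure_next_record_le hb ha hd _ (by positivity) h1).trans ?_
  apply ENNReal.ofReal_le_ofReal
  rw [mul_assoc, ← Real.rpow_add (by positivity)]
  rwa [neg_mul] at h2

/-- From a doomed state, the pre-measure of the remaining set has an exponential gain. -/
lemma exists_preHausdorff_recordSet_le (hb : 2 ≤ b) (ha : StrictMono a) (ha0 : 0 < a 0)
    (hη : 1 < η) (hlim : Tendsto (fun n : ℕ => (a (n + 1) : ℝ) / (a n : ℝ)) atTop (𝓝 η))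
    (hv : 0 < v) (hs : 0 < s) (N₀ : ℕ) {r : ENNReal} (hr : 0 < r)
    (h : Doomed η s ((1 - s) * η / v) S) :
    ∃ δ > 0, ∀ᶠ n in atTop, ∀ p : ℤ, preHausdorff s r (recordSet b a v N₀ n p) ≤
      ENNReal.ofReal ((b : ℝ) ^ (-((1 - v / η * S + δ) * a n))) := by
  have hb1 : (1 : ℝ) < b := by exact_mod_cast hb
  have haT := tendsto_cast_atTop_of_strictMono ha
  induction h with
  | mk S h ih =>
    have hmono : ∀ n : ℕ, ∀ δ δ' : ℝ, δ' ≤ δ →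
        ENNReal.ofReal ((b : ℝ) ^ (-((1 - v / η * S + δ) * a n))) ≤
        ENNReal.ofReal ((b : ℝ) ^ (-((1 - v / η * S + δ') * a n))) := by
      intro n δ δ' hδ
      gcongr
      exact hb1.le
    -- Records followed by a gap larger than `D` all lie in one sufficiently short interval, so only
    -- finitely many gaps need separate treatment and a common `δ` exists.
    obtain ⟨D, hD⟩ : ∃ D : ℕ, (1 - s) * η / v < S + s * η ^ (D + 1) := by
      have hlim : Tendsto (fun D : ℕ => S + s * η ^ (D + 1)) atTop atTop := by
        refine tendsto_atTop_add_const_left _ _ (Tendsto.const_mul_atTop hs ?_)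
        exact (tendsto_pow_atTop_atTop_of_one_lt hη).comp (tendsto_add_atTop_nat 1)
      exact (hlim.eventually (eventually_gt_atTop _)).exists
    obtain ⟨δ₁, hδ₁, hlast⟩ := exists_preHausdorff_short_le hb ha ha0 hη hlim hv hs N₀ hr
      (Nat.succ_le_succ (Nat.zero_le D)) hD
    obtain ⟨δ₂, hδ₂, hfirst⟩ := exists_pos_forall_mem_finset (Finset.Icc 1 D)
      (P := fun d δ => ∀ᶠ n in atTop, ∀ p : ℤ,
        preHausdorff s r {ξ ∈ recordSet b a v N₀ n p |
          distNearestInt ((b : ℝ) ^ (a n) * ξ) < (b : ℝ) ^ (-(v * a (n + d - 1))) ∧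
          IsRecord (fun n => distNearestInt ((b : ℝ) ^ (a n) * ξ)) (n + d)} ≤
        ENNReal.ofReal ((b : ℝ) ^ (-((1 - v / η * S + δ) * a n))))
      (fun d δ δ' hδ hd => hd.mono fun n hn p => (hn p).trans (hmono n _ _ hδ))
      (fun d hd => by
        have hd1 := (Finset.mem_Icc.1 hd).1
        rcases le_or_gt (S + s * η ^ d) ((1 - s) * η / v) with hle | hgt
        · exact exists_preHausdorff_next_le hb ha ha0 hη hlim N₀ hd1 (ih d hd1 hle)
        · obtain ⟨δ, hδ, h1⟩ := exists_preHausdorff_short_le hb ha ha0 hη hlim hv hs N₀ hr hd1 hgt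
          refine ⟨δ, hδ, h1.mono fun n hn p => le_trans ?_ (hn p)⟩
          exact MeasureTheory.measure_mono fun ξ hξ => ⟨hξ.1, hξ.2.1⟩)
    set δ := min δ₁ δ₂ with hδ
    have hδ0 : 0 < δ := lt_min hδ₁ hδ₂
    -- Half of the gain pays for the `D + 1` pieces.
    refine ⟨δ / 2, by positivity, ?_⟩
    filter_upwards [hlast, (Filter.eventually_all_finset _).2 hfirst, eventually_ge_atTop N₀,
      eventually_const_mul_rpow_le hb1 haT
        (tendsto_div_self_mul ha ha0 (-(1 - v / η * S + δ)))
        (show _ < -(1 - v / η * S + δ / 2) by linarith) (D + 1)] with n h1 h2 hN h3 p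
    have hsub : recordSet b a v N₀ n p ⊆
        (⋃ d ∈ Finset.Icc 1 D, {ξ ∈ recordSet b a v N₀ n p |
          distNearestInt ((b : ℝ) ^ (a n) * ξ) < (b : ℝ) ^ (-(v * a (n + d - 1))) ∧
          IsRecord (fun n => distNearestInt ((b : ℝ) ^ (a n) * ξ)) (n + d)}) ∪
        {ξ ∈ recordSet b a v N₀ n p |
          distNearestInt ((b : ℝ) ^ (a n) * ξ) < (b : ℝ) ^ (-(v * a (n + D.succ - 1)))} := by
      intro ξ hξ
      obtain ⟨d, hd, hrec, hsm⟩ := exists_next_record hb ha hv hξ.1 hξ.2.1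
      rcases le_or_gt d D with hdD | hdD
      · exact Or.inl (mem_iUnion₂.2 ⟨d, Finset.mem_Icc.2 ⟨hd, hdD⟩, hξ, hsm hN, hrec⟩)
      · refine Or.inr ⟨hξ, (hsm hN).trans_le ?_⟩
        have : a (n + D.succ - 1) ≤ a (n + d - 1) := ha.monotone (by omega)
        gcongr
        exact hb1.le
    refine (MeasureTheory.measure_mono hsub).trans ((MeasureTheory.measure_union_le _ _).trans ?_)
    calc _ ≤ (∑ d ∈ Finset.Icc 1 D, ENNReal.ofReal ((b : ℝ) ^ (-((1 - v / η * S + δ) * a n)))) +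
          ENNReal.ofReal ((b : ℝ) ^ (-((1 - v / η * S + δ) * a n))) := by
            refine add_le_add ((MeasureTheory.measure_biUnion_finset_le _ _).trans
              (Finset.sum_le_sum fun d hd => (h2 d hd p).trans (hmono n _ _ (min_le_right _ _)))) ?_
            exact (h1 p).trans (hmono n _ _ (min_le_left _ _))
      _ = ENNReal.ofReal ((D + 1) * (b : ℝ) ^ (-((1 - v / η * S + δ) * a n))) := by
            rw [ENNReal.ofReal_mul (by positivity), Finset.sum_const, Nat.card_Icc,
              nsmul_eq_mul, Nat.add_sub_cancel, ENNReal.ofReal_add (by positivity) (by norm_num),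
              ENNReal.ofReal_natCast, ENNReal.ofReal_one, add_one_mul]
      _ ≤ _ := by
            apply ENNReal.ofReal_le_ofReal
            rwa [neg_mul, neg_mul] at h3

end Cover

lemma exists_record_ge {b : ℕ} (hb : 2 ≤ b) {a : ℕ → ℕ} (ha : StrictMono a) {v : ℝ} (hv : 0 < v)
    {N₀ : ℕ} {ξ : ℝ} (hξ : ξ ∈ approxSet b a v N₀) (m : ℕ) :
    ∃ n, m ≤ n ∧ IsRecord (fun n => distNearestInt ((b : ℝ) ^ (a n) * ξ)) n := by
  induction m with
  | zero => exact ⟨0, le_rfl, fun m hm => absurd hm (Nat.not_lt_zero m)⟩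
  | succ m ih =>
    obtain ⟨n, hn, hr⟩ := ih
    obtain ⟨d, hd, hr', _⟩ := exists_next_record hb ha hv hξ hr
    exact ⟨n + d, by omega, hr'⟩

/-- Starting from state `0`, each piece has size `b ^ (-(1 + δ) * a n)` and there are `O(b ^ a n)`
of them. The sums converge and every point has infinitely many records, so Borel–Cantelli applies to
the pre-measure. -/
lemma hausdorffMeasure_approxSet_eq_zero {b : ℕ} (hb : 2 ≤ b) {a : ℕ → ℕ} (ha : StrictMono a)
    (ha0 : 0 < a 0) {η v s : ℝ} (hη : 1 < η)
    (hlim : Tendsto (fun n : ℕ => (a (n + 1) : ℝ) / (a n : ℝ)) atTop (𝓝 η))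
    (hv : 0 < v) (hs : 0 < s) (h : ∀ d : ℕ, dimFun η v (η ^ d) < s) (N₀ M : ℕ) :
    MeasureTheory.Measure.hausdorffMeasure s (approxSet b a v N₀ ∩ Icc (-M : ℝ) M) = 0 := by
  have hb1 : (1 : ℝ) < b := by exact_mod_cast hb
  refine hausdorffMeasure_eq_zero_of_preHausdorff fun r hr => ?_
  obtain ⟨δ, hδ, hev⟩ := exists_preHausdorff_recordSet_le hb ha ha0 hη hlim hv hs N₀ hr
    (doomed_of_dimFun_lt hη hv hs h le_rfl)
  obtain ⟨n₀, hn₀⟩ := eventually_atTop.1 hev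
  simp only [mul_zero, sub_zero] at hn₀
  set F : ℕ → Finset ℤ := fun n => Finset.Icc (-(M * b ^ a n + 1)) (M * b ^ a n + 1) with hF
  set A : ℕ → Set ℝ := fun k => ⋃ p ∈ F (k + n₀), recordSet b a v N₀ (k + n₀) p with hA
  have hle : ∀ k, preHausdorff s r (A k) ≤
      ENNReal.ofReal (2 * M + 3) * ENNReal.ofReal ((b : ℝ) ^ (-δ)) ^ k := by
    intro k
    have hbk : (1 : ℝ) ≤ (b : ℝ) ^ a (k + n₀) := one_le_pow₀ hb1.le
    have hcard : ((F (k + n₀)).card : ℝ) ≤ (2 * M + 3) * (b : ℝ) ^ a (k + n₀) := by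
      have : (((F (k + n₀)).card : ℤ) : ℝ) = 2 * (M * (b : ℝ) ^ a (k + n₀)) + 3 := by
        rw [hF]
        simp only [Int.card_Icc]
        rw [Int.toNat_of_nonneg (by have : (0 : ℤ) ≤ M * b ^ a (k + n₀) := by positivity
                                    omega)]
        push_cast
        ring
      rw [Int.cast_natCast] at this
      rw [this]
      nlinarith
    calc preHausdorff s r (A k)
        ≤ ∑ p ∈ F (k + n₀), preHausdorff s r (recordSet b a v N₀ (k + n₀) p) :=
          MeasureTheory.measure_biUnion_finset_le _ _
      _ ≤ ∑ p ∈ F (k + n₀), ENNReal.ofReal ((b : ℝ) ^ (-((1 + δ) * a (k + n₀)))) :=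
          Finset.sum_le_sum fun p _ => hn₀ _ (by omega) p
      _ = ENNReal.ofReal ((F (k + n₀)).card * (b : ℝ) ^ (-((1 + δ) * a (k + n₀)))) := by
          rw [Finset.sum_const, nsmul_eq_mul, ENNReal.ofReal_mul (by positivity),
            ENNReal.ofReal_natCast]
      _ ≤ ENNReal.ofReal ((2 * M + 3) * ((b : ℝ) ^ (-δ)) ^ k) := by
          apply ENNReal.ofReal_le_ofReal
          calc _ ≤ (2 * M + 3) * (b : ℝ) ^ a (k + n₀) *
                (b : ℝ) ^ (-((1 + δ) * a (k + n₀))) := by gcongr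
            _ = (2 * M + 3) * (b : ℝ) ^ (-δ * a (k + n₀)) := by
              rw [mul_assoc, ← Real.rpow_natCast, ← Real.rpow_add (by positivity)]
              ring_nf
            _ ≤ (2 * M + 3) * (b : ℝ) ^ (-δ * k) := by
              have : k ≤ a (k + n₀) := (Nat.le_add_right k n₀).trans (ha.le_apply)
              have : (k : ℝ) ≤ a (k + n₀) := by exact_mod_cast this
              have : -δ * a (k + n₀) ≤ -δ * k := by nlinarith
              gcongr
              exact hb1.le
            _ = _ := by rw [Real.rpow_mul (by positivity), Real.rpow_natCast]
      _ = _ := by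
          rw [ENNReal.ofReal_mul (by positivity), ENNReal.ofReal_pow (by positivity)]
  have hsum : ∑' k, preHausdorff s r (A k) ≠ ⊤ := by
    refine ne_top_of_le_ne_top ?_ (ENNReal.tsum_le_tsum hle)
    rw [ENNReal.tsum_mul_left, ENNReal.tsum_geometric]
    refine ENNReal.mul_ne_top ENNReal.ofReal_ne_top (ENNReal.inv_ne_top.2 ?_)
    rw [Ne, tsub_eq_zero_iff_le, not_le, ENNReal.ofReal_lt_one]
    exact Real.rpow_lt_one_of_one_lt_of_neg hb1 (by linarith)
  refine MeasureTheory.measure_mono_null ?_ (MeasureTheory.measure_limsup_atTop_eq_zero hsum)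
  rintro ξ ⟨hξ, hM⟩
  rw [mem_limsup_iff_frequently_mem, frequently_atTop]
  intro m
  obtain ⟨n, hn, hrec⟩ := exists_record_ge hb ha hv hξ (m + n₀)
  refine ⟨n - n₀, by omega, ?_⟩
  have hn' : n - n₀ + n₀ = n := by omega
  simp only [hA, hn']
  refine mem_iUnion₂.2 ⟨round ((b : ℝ) ^ a n * ξ), ?_, hξ, hrec, rfl⟩
  have h1 := abs_sub_round ((b : ℝ) ^ a n * ξ)
  have hpow : (0 : ℝ) < (b : ℝ) ^ a n := by positivity
  have h2 : (b : ℝ) ^ a n * ξ ≤ (b : ℝ) ^ a n * M := by gcongr; exact hM.2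
  have h3 : (b : ℝ) ^ a n * (-M) ≤ (b : ℝ) ^ a n * ξ := by gcongr; exact hM.1
  rw [abs_le] at h1
  rw [hF, Finset.mem_Icc]
  constructor
  · have : ((-(M * b ^ a n + 1) : ℤ) : ℝ) ≤ round ((b : ℝ) ^ a n * ξ) := by
      push_cast; linarith [h1.1, h1.2]
    exact_mod_cast this
  · have : (round ((b : ℝ) ^ a n * ξ) : ℝ) ≤ ((M * b ^ a n + 1 : ℤ) : ℝ) := by
      push_cast; linarith [h1.1, h1.2]
    exact_mod_cast this

lemma uniformGeSet_subset {b : ℕ} (hb : 2 ≤ b) (a : ℕ → ℕ) {v v' : ℝ} (hvv : v' < v) :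
    uniformGeSet b a v ⊆ (⋃ q : ℕ × ℕ, approxSet b a v' q.1 ∩ Icc (-q.2 : ℝ) q.2) ∪
      range fun q : ℕ × ℤ => (q.2 : ℝ) / (b : ℝ) ^ q.1 := by
  intro ξ hξ
  have hb1 : (1 : ℝ) < b := by exact_mod_cast hb
  by_cases h0 : ∀ n, 0 < distNearestInt ((b : ℝ) ^ (a n) * ξ)
  · left
    have h1 : (v' : EReal) < uniformExponent b a ξ := (EReal.coe_lt_coe_iff.2 hvv).trans_le hξ
    obtain ⟨_, ⟨w, ⟨_, hw⟩, rfl⟩, hvw⟩ := lt_sSup_iff.1 h1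
    have hvw := EReal.coe_lt_coe_iff.1 hvw
    obtain ⟨N₀, hN₀⟩ := eventually_atTop.1 hw
    obtain ⟨M, hM⟩ := exists_nat_ge |ξ|
    refine mem_iUnion.2 ⟨(N₀, M), ⟨fun N hN => ?_, h0⟩, abs_le.1 hM⟩
    obtain ⟨n, hn, hn'⟩ := hN₀ N hN
    refine ⟨n, hn, hn'.trans_le ?_⟩
    have : 1 ≤ (b : ℝ) ^ a N := one_le_pow₀ hb1.le
    gcongr
  · right
    push Not at h0
    obtain ⟨n, hn⟩ := h0
    have : (b : ℝ) ^ a n * ξ - round ((b : ℝ) ^ a n * ξ) = 0 := abs_nonpos_iff.1 hn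
    refine ⟨(a n, round ((b : ℝ) ^ a n * ξ)), ?_⟩
    have hpow : (0 : ℝ) < (b : ℝ) ^ a n := by positivity
    simp only
    rw [div_eq_iff hpow.ne']
    linarith

/-- The upper bound for the Hausdorff dimension. -/
theorem dimH_uniformGeSet_le {b : ℕ} (hb : 2 ≤ b) {a : ℕ → ℕ} (ha : StrictMono a)
    (ha0 : 0 < a 0) {η v D : ℝ} (hη : 1 < η)
    (hlim : Tendsto (fun n : ℕ => (a (n + 1) : ℝ) / (a n : ℝ)) atTop (𝓝 η))
    (hv : 0 < v) (hD : 0 ≤ D) (h : ∀ d : ℕ, dimFun η v (η ^ d) ≤ D) :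
    dimH (uniformGeSet b a v) ≤ ENNReal.ofReal D := by
  refine ENNReal.le_of_forall_pos_le_add fun ε hε _ => ?_
  have hs : 0 < D + ε := by positivity
  obtain ⟨v', hv', hvv, hd⟩ := exists_dimFun_lt hη hv (show D < D + ε by simpa using hε) h
  have hcoe : ENNReal.ofReal D + ε = ((D + ε).toNNReal : ENNReal) := by
    rw [← ENNReal.ofReal, ENNReal.ofReal_add hD ε.coe_nonneg, ENNReal.ofReal_coe_nnreal]
  rw [hcoe]
  refine (dimH_mono (uniformGeSet_subset hb a hvv)).trans ?_
  rw [dimH_union, dimH_iUnion, dimH_countable (countable_range _)]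
  refine max_le (iSup_le fun q => dimH_le_of_hausdorffMeasure_ne_top ?_) bot_le
  rw [Real.coe_toNNReal _ hs.le,
    hausdorffMeasure_approxSet_eq_zero hb ha ha0 hη hlim hv' hs hd q.1 q.2]
  exact ENNReal.zero_ne_top

/-! ### Spreading digits over a set of positions. -/

/-- Place the last `J` base `b` digits of `m` at the positions `pos 0, …, pos (J - 1)`. -/
noncomputable def spreadNat (b : ℕ) (pos : ℕ → ℕ) : ℕ → ℕ → ℝ
  | 0, _ => 0
  | J + 1, m => spreadNat b pos J (m / b) + ((m % b : ℕ) : ℝ) / (b : ℝ) ^ pos J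

/-- Place the base `b` digits of `x` at the positions `pos 0, pos 1, …`. -/
noncomputable def spread (b : ℕ) (pos : ℕ → ℕ) (x : ℝ) : ℝ :=
  ⨆ J : ℕ, spreadNat b pos J ⌊(b : ℝ) ^ J * x⌋₊

section Spread

variable {b : ℕ} {pos : ℕ → ℕ}

lemma mul_inv_pow_pos_succ_le (hb : 2 ≤ b) (hpos : StrictMono pos) (J : ℕ) :
    (b : ℝ) / (b : ℝ) ^ pos (J + 1) ≤ 1 / (b : ℝ) ^ pos J := by
  have hb1 : (1 : ℝ) < b := by exact_mod_cast hb
  rw [div_le_div_iff₀ (by positivity) (by positivity), one_mul, ← pow_succ']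
  exact pow_le_pow_right₀ hb1.le (hpos (Nat.lt_succ_self J))

/-- Without a carry the last digit alone gives the gap. With a carry, the digit falls from `b - 1`
to `0`, but the higher digits gain at least `b / b ^ pos J`, leaving `1 / b ^ pos J`. -/
lemma spreadNat_add_one (hb : 2 ≤ b) (hpos : StrictMono pos) {J m : ℕ} (hm : m + 1 < b ^ J) :
    spreadNat b pos J m + b / (b : ℝ) ^ pos J ≤ spreadNat b pos J (m + 1) := by
  induction J generalizing m with
  | zero => simp at hm
  | succ J ih =>
    have hb0 : 0 < b := by omega
    have hstep := mul_inv_pow_pos_succ_le hb hpos J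
    have hpow : (0 : ℝ) < (b : ℝ) ^ pos J := by positivity
    simp only [spreadNat]
    rw [Nat.succ_div, Nat.add_mod]
    split_ifs with hdvd
    · have hmod : m % b = b - 1 := by
        have h1 := Nat.mod_lt m hb0
        have h2 : (m % b + 1) % b = 0 := by
          rw [Nat.mod_add_mod]; exact Nat.mod_eq_zero_of_dvd hdvd
        by_contra hne
        rw [Nat.mod_eq_of_lt (by omega)] at h2
        omega
      have h3 : (m / b) + 1 < b ^ J := by
        have : (m + 1) / b = m / b + 1 := by rw [Nat.succ_div, if_pos hdvd]
        rw [← this]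
        apply Nat.div_lt_of_lt_mul
        rwa [← pow_succ']
      have h4 := ih h3
      rw [Nat.mod_eq_of_lt (show 1 < b by omega), hmod, Nat.sub_add_cancel (by omega), Nat.mod_self,
        Nat.cast_sub (by omega)]
      have h5 : ((b : ℝ) - (1 : ℕ)) / (b : ℝ) ^ pos J
          = b / (b : ℝ) ^ pos J - 1 / (b : ℝ) ^ pos J := by
        rw [sub_div, Nat.cast_one]
      rw [h5, Nat.cast_zero, zero_div]
      linarith
    · have h1 := Nat.mod_lt m hb0
      have hlt : m % b + 1 < b := by
        by_contra hcon
        refine hdvd (Nat.dvd_of_mod_eq_zero ?_)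
        rw [← Nat.mod_add_mod, show m % b + 1 = b by omega, Nat.mod_self]
      rw [Nat.mod_eq_of_lt (show 1 < b by omega), Nat.mod_eq_of_lt hlt]
      push_cast
      rw [add_div, add_zero]
      linarith

lemma spreadNat_add (hb : 2 ≤ b) (hpos : StrictMono pos) {J m k : ℕ} (hm : m + k < b ^ J) :
    spreadNat b pos J m + k * (b / (b : ℝ) ^ pos J) ≤ spreadNat b pos J (m + k) := by
  induction k with
  | zero => simp
  | succ k ih =>
    have h1 := ih (by omega)
    have h2 := spreadNat_add_one hb hpos (show m + k + 1 < b ^ J by omega)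
    rw [← add_assoc]
    push_cast
    linarith

lemma floor_pow_succ_mul_div (hb : 2 ≤ b) (J : ℕ) (x : ℝ) :
    ⌊(b : ℝ) ^ (J + 1) * x⌋₊ / b = ⌊(b : ℝ) ^ J * x⌋₊ := by
  have hb0 : (b : ℝ) ≠ 0 := by positivity
  rw [← Nat.floor_div_natCast, pow_succ]
  congr 1
  field_simp

/-- Truncations increase with `J`, while truncation plus maximal tail decreases, so the supremum is
squeezed between them. -/
lemma spreadNat_le_spread (hb : 2 ≤ b) (hpos : StrictMono pos) (x : ℝ) (J : ℕ) :
    spreadNat b pos J ⌊(b : ℝ) ^ J * x⌋₊ ≤ spread b pos x ∧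
    spread b pos x ≤ spreadNat b pos J ⌊(b : ℝ) ^ J * x⌋₊ + b / (b : ℝ) ^ pos J := by
  have hb0 : 0 < b := by omega
  set f : ℕ → ℝ := fun J => spreadNat b pos J ⌊(b : ℝ) ^ J * x⌋₊ with hf
  set g : ℕ → ℝ := fun J => f J + b / (b : ℝ) ^ pos J with hg
  have hstep : ∀ J, f (J + 1) = f J + ((⌊(b : ℝ) ^ (J + 1) * x⌋₊ % b : ℕ) : ℝ) / (b : ℝ) ^ pos J := by
    intro J
    simp only [hf, spreadNat]
    rw [floor_pow_succ_mul_div hb]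
  have hfm : Monotone f := monotone_nat_of_le_succ fun J => by
    rw [hstep]
    exact le_add_of_nonneg_right (by positivity)
  have hga : Antitone g := antitone_nat_of_succ_le fun J => by
    simp only [hg]
    rw [hstep]
    have h1 := mul_inv_pow_pos_succ_le hb hpos J
    have h2 : ((⌊(b : ℝ) ^ (J + 1) * x⌋₊ % b : ℕ) : ℝ) + 1 ≤ b := by
      exact_mod_cast Nat.mod_lt _ hb0
    have h3 : ((⌊(b : ℝ) ^ (J + 1) * x⌋₊ % b : ℕ) : ℝ) / (b : ℝ) ^ pos J + 1 / (b : ℝ) ^ pos J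
        ≤ b / (b : ℝ) ^ pos J := by
      rw [← add_div]
      gcongr
    linarith
  have hfg : ∀ J K, f J ≤ g K := by
    intro J K
    calc f J ≤ f (max J K) := hfm (le_max_left _ _)
      _ ≤ g (max J K) := le_add_of_nonneg_right (by positivity)
      _ ≤ g K := hga (le_max_right _ _)
  exact ⟨le_ciSup (f := f) ⟨g 0, by rintro _ ⟨J, rfl⟩; exact hfg J 0⟩ J,
    ciSup_le (f := f) fun K => hfg K J⟩

lemma exists_nat_eq_pow_mul_spreadNat (hb : 2 ≤ b) {J k : ℕ} (h : ∀ j < J, pos j ≤ k) (m : ℕ) :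
    ∃ z : ℕ, (b : ℝ) ^ k * spreadNat b pos J m = z := by
  induction J generalizing m with
  | zero => exact ⟨0, by simp [spreadNat]⟩
  | succ J ih =>
    obtain ⟨z, hz⟩ := ih (fun j hj => h j (by omega)) (m / b)
    refine ⟨z + m % b * b ^ (k - pos J), ?_⟩
    have hb0 : (b : ℝ) ≠ 0 := by positivity
    rw [spreadNat, mul_add, hz]
    push_cast
    rw [pow_sub₀ _ hb0 (h J (Nat.lt_succ_self J))]
    ring

/-- The truncated integers differ by at least `2`: one unit pays for the tail of `x`, the other
gives the gap. -/
lemma spread_sub_spread_ge (hb : 2 ≤ b) (hpos : StrictMono pos) {x y : ℝ} (hx : 0 ≤ x)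
    (hy : y < 1) {J : ℕ} (hJ : 2 ≤ (b : ℝ) ^ J * (y - x)) :
    1 / (b : ℝ) ^ pos J ≤ spread b pos y - spread b pos x := by
  have hbJ : (0 : ℝ) < (b : ℝ) ^ J := by positivity
  have hb1 : (1 : ℝ) ≤ b := by exact_mod_cast (by omega : 1 ≤ b)
  have h1 : ⌊(b : ℝ) ^ J * x⌋₊ + 2 ≤ ⌊(b : ℝ) ^ J * y⌋₊ := by
    rw [← Nat.floor_add_natCast (by positivity)]
    apply Nat.floor_le_floor
    push_cast
    linarith
  have h2 : ⌊(b : ℝ) ^ J * y⌋₊ < b ^ J := by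
    rw [Nat.floor_lt (by nlinarith)]
    push_cast
    nlinarith
  obtain ⟨k, hk⟩ := Nat.exists_eq_add_of_le h1
  have h3 := spreadNat_add hb hpos (J := J) (m := ⌊(b : ℝ) ^ J * x⌋₊) (k := 2 + k) (by omega)
  rw [← add_assoc, ← hk] at h3
  have h4 := (spreadNat_le_spread hb hpos x J).2
  have h5 := (spreadNat_le_spread hb hpos y J).1
  have h6 : 1 / (b : ℝ) ^ pos J ≤ b / (b : ℝ) ^ pos J := by gcongr
  have h7 : 0 ≤ (k : ℝ) * (b / (b : ℝ) ^ pos J) := by positivity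
  push_cast at h3
  linarith

/-- Hölder continuity of the inverse. At the first level `J + 1` that separates the points, `y - x <
2 / b ^ J` while the images differ by at least `b ^ (-pos (J + 1))`; `hC` compares these. -/
lemma sub_le_spread_rpow (hb : 2 ≤ b) (hpos : StrictMono pos) {s C : ℝ} (hs : 0 < s)
    (hC : ∀ J, s * pos J ≤ J + C) {x y : ℝ} (hx : 0 ≤ x) (hxy : x < y) (hy : y < 1) :
    spread b pos x < spread b pos y ∧
      y - x ≤ 2 * b * (b : ℝ) ^ C * (spread b pos y - spread b pos x) ^ s := by
  have hb1 : (1 : ℝ) < b := by exact_mod_cast hb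
  have hex : ∃ J : ℕ, 2 ≤ (b : ℝ) ^ J * (y - x) :=
    (((tendsto_pow_atTop_atTop_of_one_lt hb1).atTop_mul_const (sub_pos.2 hxy)).eventually
      (eventually_ge_atTop 2)).exists
  classical
  obtain ⟨J, hJ, hmin⟩ : ∃ J : ℕ, 2 ≤ (b : ℝ) ^ (J + 1) * (y - x) ∧ (b : ℝ) ^ J * (y - x) < 2 := by
    have h0 : Nat.find hex ≠ 0 := by
      intro h
      have := Nat.find_spec hex
      rw [h] at this
      linarith
    obtain ⟨J, hJ⟩ := Nat.exists_eq_succ_of_ne_zero h0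
    refine ⟨J, ?_, not_le.1 (Nat.find_min hex (by omega))⟩
    have := Nat.find_spec hex
    rwa [hJ] at this
  have h1 := spread_sub_spread_ge hb hpos hx hy hJ
  have h2 : 0 < 1 / (b : ℝ) ^ pos (J + 1) := by positivity
  refine ⟨by linarith, ?_⟩
  have h3 : (b : ℝ) ^ (-((J : ℝ) + 1 + C)) ≤ (spread b pos y - spread b pos x) ^ s := by
    calc (b : ℝ) ^ (-((J : ℝ) + 1 + C)) ≤ (b : ℝ) ^ (-(s * pos (J + 1))) := by
          have := hC (J + 1)
          push_cast at this
          gcongr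
          exact hb1.le
      _ = (1 / (b : ℝ) ^ pos (J + 1)) ^ s := by
          rw [one_div, ← Real.rpow_natCast, ← Real.rpow_neg (by positivity),
            ← Real.rpow_mul (by positivity)]
          ring_nf
      _ ≤ _ := by gcongr
  calc y - x ≤ 2 / (b : ℝ) ^ J := by
        rw [le_div_iff₀ (by positivity)]
        linarith
    _ = 2 * b * (b : ℝ) ^ C * (b : ℝ) ^ (-((J : ℝ) + 1 + C)) := by
        have hbC : (0 : ℝ) < (b : ℝ) ^ C := by positivity
        rw [Real.rpow_neg (by positivity), Real.rpow_add (by positivity),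
          Real.rpow_add (by positivity), Real.rpow_one, Real.rpow_natCast]
        field_simp
    _ ≤ _ := by gcongr

/-- If at least a proportion `s` of the positions is used, spreading digits multiplies
dimensions by at least `s`. -/
lemma dimH_le_dimH_spread_image (hb : 2 ≤ b) (hpos : StrictMono pos) {s : NNReal} {C : ℝ}
    (hs : 0 < s) (hC : ∀ J, s * pos J ≤ J + C) {A : Set ℝ} (hA : A ⊆ Ico 0 1) :
    dimH A ≤ dimH (spread b pos '' A) / s := by
  have key : ∀ x ∈ A, ∀ y ∈ A, |x - y| ≤
      2 * b * (b : ℝ) ^ C * |spread b pos x - spread b pos y| ^ (s : ℝ) := by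
    intro x hx y hy
    rcases lt_trichotomy x y with h | rfl | h
    · obtain ⟨h1, h2⟩ := sub_le_spread_rpow hb hpos hs hC (hA hx).1 h (hA hy).2
      rwa [abs_sub_comm, abs_of_pos (sub_pos.2 h), abs_sub_comm (spread b pos x),
        abs_of_pos (sub_pos.2 h1)]
    · simp only [sub_self, abs_zero]
      positivity
    · obtain ⟨h1, h2⟩ := sub_le_spread_rpow hb hpos hs hC (hA hy).1 h (hA hx).2
      rwa [abs_of_pos (sub_pos.2 h), abs_of_pos (sub_pos.2 h1)]
  have hinj : InjOn (spread b pos) A := by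
    intro x hx y hy hxy
    have := key x hx y hy
    rw [hxy, sub_self, abs_zero, Real.zero_rpow (by exact_mod_cast hs.ne'), mul_zero] at this
    exact sub_eq_zero.1 (abs_nonpos_iff.1 this)
  set g := Function.invFunOn (spread b pos) A with hg
  have hgl : LeftInvOn g (spread b pos) A := hinj.leftInvOn_invFunOn
  have hholder : HolderOnWith (2 * b * (b : ℝ) ^ C).toNNReal s g (spread b pos '' A) := by
    rintro _ ⟨x, hx, rfl⟩ _ ⟨y, hy, rfl⟩
    rw [hgl hx, hgl hy, edist_dist, edist_dist, Real.dist_eq, Real.dist_eq,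
      ENNReal.ofReal_rpow_of_nonneg (abs_nonneg _) s.coe_nonneg, ← ENNReal.ofReal.eq_1,
      ← ENNReal.ofReal_mul (by positivity)]
    exact ENNReal.ofReal_le_ofReal (key x hx y hy)
  have := hholder.dimH_image_le hs
  rwa [hgl.image_image] at this

end Spread

/-! ### Density of the free positions. -/

/-- The positions outside all the runs `(x k, x k + c k]`. -/
def IsFreePos (x c : ℕ → ℕ) (i : ℕ) : Prop := ∀ k, x k < i → x k + c k < i

section FreePos

variable {x c : ℕ → ℕ}

lemma isFreePos_start (hx : StrictMono x) (hc : ∀ k, x k + c k < x (k + 1)) (k : ℕ) :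
    IsFreePos x c (x k) := fun j hj =>
  (hc j).trans_le (hx.monotone (Nat.succ_le_of_lt (hx.lt_iff_lt.1 hj)))

lemma infinite_isFreePos (hx : StrictMono x) (hc : ∀ k, x k + c k < x (k + 1)) :
    (Set.ofPred (IsFreePos x c)).Infinite := by
  refine Set.infinite_of_injective_forall_mem hx.injective fun k => ?_
  exact isFreePos_start hx hc k

/-- A lower bound for the number of free positions below a given free position. -/
lemma mul_nth_isFreePos_le (hx : StrictMono x) (hc : ∀ k, x k + c k < x (k + 1)) {s C : ℝ}
    (hs : s ≤ 1) (hC0 : 0 ≤ C)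
    (hC : ∀ k, ((∑ j ∈ Finset.range (k + 1), c j : ℕ) : ℝ) ≤ (1 - s) * (x k + c k) + C) (J : ℕ) :
    s * Nat.nth (IsFreePos x c) J ≤ J + C := by
  classical
  have hinf := infinite_isFreePos hx hc
  have hi := Nat.nth_mem_of_infinite hinf J
  have hcount := Nat.count_nth_of_infinite hinf J
  set i := Nat.nth (IsFreePos x c) J with hidef
  have hsub : ∀ K : ℕ, (∀ k, x k < i → k < K) →
      i ≤ J + ∑ j ∈ Finset.range K, c j := by
    intro K hK
    have : Finset.range i ⊆ (Finset.range i).filter (IsFreePos x c) ∪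
        (Finset.range K).biUnion fun j => Finset.Ioc (x j) (x j + c j) := by
      intro m hm
      rw [Finset.mem_union, Finset.mem_filter, Finset.mem_biUnion]
      by_cases hf : IsFreePos x c m
      · exact Or.inl ⟨hm, hf⟩
      · right
        unfold IsFreePos at hf
        push Not at hf
        obtain ⟨k, hk, hk'⟩ := hf
        exact ⟨k, Finset.mem_range.2 (hK k (hk.trans (Finset.mem_range.1 hm))),
          Finset.mem_Ioc.2 ⟨hk, hk'⟩⟩
    have h1 := (Finset.card_le_card this).trans (Finset.card_union_le _ _)
    rw [Finset.card_range, ← Nat.count_eq_card_filter_range, hcount] at h1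
    refine h1.trans (Nat.add_le_add_left (Finset.card_biUnion_le.trans ?_) _)
    simp
  by_cases h0 : x 0 < i
  -- `K` is the last run starting before `i`. As `i` is free it lies beyond the end of that run, so
  -- the density bound at the ends of runs suffices.
  · obtain ⟨K, hK, hmax⟩ : ∃ K, x K < i ∧ ∀ k, x k < i → k < K + 1 := by
      have hb : ∀ k, x k < i → k ≤ i := fun k hk => hx.le_apply.trans hk.le
      exact ⟨Nat.findGreatest (fun k => x k < i) i, Nat.findGreatest_spec (P := fun k => x k < i) (Nat.zero_le i) h0,
        fun k hk => Nat.lt_succ_of_le (Nat.le_findGreatest (hb k hk) hk)⟩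
    have h1 : (i : ℝ) ≤ J + (∑ j ∈ Finset.range (K + 1), c j : ℕ) := by
      exact_mod_cast hsub _ hmax
    have h2 : (x K : ℝ) + c K ≤ i := by exact_mod_cast (hi K hK).le
    have h3 := hC K
    have h4 : (1 - s) * (x K + c K) ≤ (1 - s) * i := by
      apply mul_le_mul_of_nonneg_left h2; linarith
    linarith
  · have h1 := hsub 0 fun k hk => absurd ((hx.monotone (Nat.zero_le k)).trans_lt hk) h0
    have h2 : (i : ℝ) ≤ J := by exact_mod_cast (by simpa using h1)
    have : (0 : ℝ) ≤ i := by positivity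
    nlinarith

/-- Numbers whose digits vanish on the runs are well approximated. -/
lemma distNearestInt_spread_le {b : ℕ} (hb : 2 ≤ b) (hx : StrictMono x)
    (hc : ∀ k, x k + c k < x (k + 1)) (y : ℝ) (k : ℕ) :
    distNearestInt ((b : ℝ) ^ x k * spread b (Nat.nth (IsFreePos x c)) y) ≤
      1 / (b : ℝ) ^ c k := by
  classical
  have hinf := infinite_isFreePos hx hc
  set pos := Nat.nth (IsFreePos x c) with hpos
  have hmono : StrictMono pos := Nat.nth_strictMono hinf
  set J := Nat.count (IsFreePos x c) (x k + 1) with hJ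
  have h1 : ∀ j < J, pos j ≤ x k := fun j hj => Nat.lt_succ_iff.1 (Nat.nth_lt_of_lt_count hj)
  have h2 : x k < pos J := Nat.le_nth_count hinf (x k + 1)
  have h3 : x k + c k + 1 ≤ pos J := (Nat.nth_mem_of_infinite hinf J) k h2
  obtain ⟨hl, hu⟩ := spreadNat_le_spread hb hmono y J
  obtain ⟨z, hz⟩ := exists_nat_eq_pow_mul_spreadNat hb h1 ⌊(b : ℝ) ^ J * y⌋₊
  set ξ := spread b pos y
  set h := spreadNat b pos J ⌊(b : ℝ) ^ J * y⌋₊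
  have hpow : (0 : ℝ) < (b : ℝ) ^ x k := by positivity
  have hb1 : (1 : ℝ) < b := by exact_mod_cast hb
  have h4 : (b : ℝ) ^ x k * (b / (b : ℝ) ^ pos J) ≤ 1 / (b : ℝ) ^ c k := by
    rw [mul_div_assoc', div_le_div_iff₀ (by positivity) (by positivity), one_mul, ← pow_succ,
      ← pow_add]
    exact pow_le_pow_right₀ hb1.le (by omega)
  have h5 : (b : ℝ) ^ x k * ξ - z ≤ 1 / (b : ℝ) ^ c k := by
    rw [← hz, ← mul_sub]
    refine le_trans ?_ h4
    gcongr
    linarith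
  have h6 : 0 ≤ (b : ℝ) ^ x k * ξ - z := by
    rw [← hz, ← mul_sub]
    apply mul_nonneg hpow.le; linarith
  calc distNearestInt ((b : ℝ) ^ x k * ξ) ≤ |(b : ℝ) ^ x k * ξ - ((z : ℤ) : ℝ)| := round_le _ _
    _ ≤ _ := by rw [Int.cast_natCast, abs_of_nonneg h6]; exact h5

end FreePos

/-- Run lengths growing proportionally to geometrically growing starting points leave a
proportion of free positions determined by the limit ratios. -/
lemma exists_sum_le_of_tendsto {x c : ℕ → ℕ} (hx0 : ∀ k, 0 < x k) {u q s : ℝ} (hu : 1 < u)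
    (hs1 : s ≤ 1)
    (hxlim : Tendsto (fun k => (x (k + 1) : ℝ) / x k) atTop (𝓝 u))
    (hclim : Tendsto (fun k => (c k : ℝ) / x k) atTop (𝓝 q))
    (hs : q * u / (u - 1) < (1 - s) * (1 + q)) :
    ∃ C, 0 ≤ C ∧
      ∀ k, ((∑ j ∈ Finset.range (k + 1), c j : ℕ) : ℝ) ≤ (1 - s) * (x k + c k) + C := by
  -- The run lengths up to `x k` sum to about `q * (1 + u⁻¹ + u⁻² + ⋯) * x k`. An `A` above `q * u /
  -- (u - 1)` satisfies `q + A / u < A`, which propagates the bound `A * x k` by induction.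
  obtain ⟨A, hA1, hA2⟩ := exists_between hs
  have hq : 0 ≤ q := ge_of_tendsto' hclim fun k => by positivity
  have hA0 : 0 ≤ A := by
    refine le_trans ?_ hA1.le
    apply div_nonneg <;> nlinarith
  have hx0' : ∀ k, (0 : ℝ) < x k := fun k => by exact_mod_cast hx0 k
  have hl1 : Tendsto (fun k => (1 - s) * (1 + (c k : ℝ) / x k)) atTop
      (𝓝 ((1 - s) * (1 + q))) := (hclim.const_add 1).const_mul _
  have hl2 : Tendsto (fun k => (c (k + 1) : ℝ) / x (k + 1) + A * ((x (k + 1) : ℝ) / x k)⁻¹) atTop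
      (𝓝 (q + A * u⁻¹)) :=
    (hclim.comp (tendsto_add_atTop_nat 1)).add ((hxlim.inv₀ (by linarith)).const_mul A)
  have hlt : q + A * u⁻¹ < A := by
    rw [div_lt_iff₀ (by linarith)] at hA1
    rw [← div_eq_mul_inv, ← lt_sub_iff_add_lt', div_lt_iff₀ (by linarith)]
    linarith
  obtain ⟨k₁, hk₁⟩ := eventually_atTop.1
    ((hl1.eventually (lt_mem_nhds hA2)).and (hl2.eventually (gt_mem_nhds hlt)))
  set B : ℕ → ℝ := fun k => ((∑ j ∈ Finset.range (k + 1), c j : ℕ) : ℝ) with hB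
  have hBmono : Monotone B := fun i j hij => by
    simp only [hB]
    exact_mod_cast Finset.sum_le_sum_of_subset (Finset.range_mono (by omega))
  have hBk : ∀ k, B (k + 1) = B k + c (k + 1) := fun k => by
    simp only [hB]
    rw [Finset.sum_range_succ c (k + 1)]
    push_cast
    rfl
  have hB0 : 0 ≤ B k₁ := by positivity
  refine ⟨B k₁, hB0, fun k => ?_⟩
  change B k ≤ _
  rcases le_total k k₁ with h | h
  · have h1 := hBmono h
    have h2 : 0 ≤ (1 - s) * ((x k : ℝ) + c k) := mul_nonneg (by linarith) (by positivity)
    linarith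
  · have h1 : B k ≤ A * x k + B k₁ := by
      induction k, h using Nat.le_induction with
      | base => nlinarith [hx0' k₁]
      | succ k hk ih =>
        have h2 := (hk₁ k hk).2
        have h3 := hx0' k
        have h4 := hx0' (k + 1)
        rw [inv_div, mul_div_assoc', ← add_div, div_lt_iff₀ h4] at h2
        rw [hBk]
        linarith
    have h2 := (hk₁ k h).1
    have h3 := hx0' k
    have h4 : (1 - s) * (1 + (c k : ℝ) / x k) * x k = (1 - s) * (x k + c k) := by
      field_simp
    have := mul_lt_mul_of_pos_right h2 h3
    rw [h4] at this
    linarith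

/-! ### The lower bound for the exact exponent. -/

/-- A set of reals of full dimension survives removing countably many sets of dimension `< 1`. -/
lemma one_le_dimH_of_subset_union {A : Set ℝ} {B : ℕ → Set ℝ} (h : Ico (0 : ℝ) 1 ⊆ A ∪ ⋃ m, B m)
    (hB : ∀ m, dimH (B m) < 1) : 1 ≤ dimH A := by
  by_contra hcon
  push Not at hcon
  -- Dimensions alone would not do: the supremum of countably many values below `1` may equal `1`.
  -- Null sets are closed under countable unions.
  have hnull : ∀ E : Set ℝ, dimH E < 1 → MeasureTheory.volume E = 0 := fun E hE => by
    have := hausdorffMeasure_of_dimH_lt (d := 1) (s := E) (by simpa using hE)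
    rwa [NNReal.coe_one, MeasureTheory.hausdorffMeasure_real] at this
  have h1 : MeasureTheory.volume (Ico (0 : ℝ) 1) = 0 :=
    MeasureTheory.measure_mono_null h (MeasureTheory.measure_union_null (hnull A hcon)
      (MeasureTheory.measure_iUnion_null fun m => hnull _ (hB m)))
  simp at h1

lemma mem_uniformEqSet_of_notMem {b : ℕ} {a : ℕ → ℕ} {v ξ : ℝ} (h : ξ ∈ uniformGeSet b a v)
    (hn : ∀ m : ℕ, ξ ∉ uniformGeSet b a (v + 1 / ((m : ℝ) + 1))) : ξ ∈ uniformEqSet b a v := by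
  refine le_antisymm ?_ h
  by_contra hcon
  obtain ⟨w, hw1, hw2⟩ := EReal.lt_iff_exists_real_btwn.1 (not_le.1 hcon)
  have hw1 := EReal.coe_lt_coe_iff.1 hw1
  obtain ⟨m, hm⟩ := exists_nat_one_div_lt (sub_pos.2 hw1)
  refine hn m (le_trans (EReal.coe_le_coe_iff.2 ?_) hw2.le)
  linarith

/-- The lower bound for the Hausdorff dimension. -/
theorem le_dimH_uniformEqSet {b : ℕ} (hb : 2 ≤ b) {a : ℕ → ℕ} (ha : StrictMono a)
    (ha0 : 0 < a 0) {η v : ℝ} (hη : 1 < η)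
    (hlim : Tendsto (fun n : ℕ => (a (n + 1) : ℝ) / (a n : ℝ)) atTop (𝓝 η))
    (hv : 0 < v) {l : ℕ} (hpos : 0 < dimFun η v (η ^ l))
    (hmax : ∀ d : ℕ, dimFun η v (η ^ d) ≤ dimFun η v (η ^ l)) :
    ENNReal.ofReal (dimFun η v (η ^ l)) ≤ dimH (uniformEqSet b a v) := by
  have hb1 : (1 : ℝ) < b := by exact_mod_cast hb
  have haT := tendsto_cast_atTop_of_strictMono ha
  have hapos : ∀ n, (0 : ℝ) < a n := fun n => by
    exact_mod_cast ha0.trans_le (ha.monotone (Nat.zero_le n))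
  set t := η ^ l with ht
  have ht1 : 1 ≤ t := one_le_pow₀ hη.le
  set d := l + 1 with hd
  -- The run after `a n` must serve every `N ≤ n + l`, the last index before the next run at `n +
  -- d`; the `+ 1` makes the inequality strict.
  set r : ℕ → ℕ := fun n => ⌊v * a (n + l)⌋₊ + 1 with hr
  have hrlim : Tendsto (fun n => (r n : ℝ) / a n) atTop (𝓝 (t * v)) := by
    have h1 : Tendsto (fun n => (⌊v * a (n + l)⌋₊ : ℝ) / (v * a (n + l))) atTop (𝓝 1) :=
      tendsto_nat_floor_div_atTop.comp
        ((haT.comp (tendsto_add_atTop_nat l)).const_mul_atTop hv)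
    have h2 := (tendsto_ratio_add ha ha0 hlim l).const_mul v
    have h3 : Tendsto (fun n => 1 / (a n : ℝ)) atTop (𝓝 0) := tendsto_const_nhds.div_atTop haT
    have h4 := (h1.mul h2).add h3
    rw [one_mul, add_zero, mul_comm v] at h4
    refine h4.congr fun n => ?_
    have := (hapos n).ne'
    have := (hapos (n + l)).ne'
    simp only [hr]
    push_cast
    field_simp
  have hden : 0 < (η * t - 1) * (1 + t * v) := mul_pos (by nlinarith) (by positivity)
  have hnum : 0 < η * t - 1 - t * v := by
    rcases div_pos_iff.1 hpos with h | h
    · exact h.1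
    · exact absurd h.2 (not_lt.2 hden.le)
  have hgap : ∀ᶠ n in atTop, a n + r n < a (n + d) := by
    have h1 : Tendsto (fun n => (a (n + d) : ℝ) / a n - (r n : ℝ) / a n) atTop
        (𝓝 (η ^ d - t * v)) := (tendsto_ratio_add ha ha0 hlim d).sub hrlim
    have h2 : 1 < η ^ d - t * v := by rw [hd, pow_succ']; linarith
    filter_upwards [h1.eventually (lt_mem_nhds h2)] with n hn
    rw [← sub_div, lt_div_iff₀ (hapos n)] at hn
    have : (a n : ℝ) + r n < a (n + d) := by linarith
    exact_mod_cast this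
  obtain ⟨k₀, hk₀⟩ := eventually_atTop.1 hgap
  set m : ℕ → ℕ := fun k => (k + k₀) * d with hm
  have hmge : ∀ k, k₀ ≤ m k := fun k =>
    (Nat.le_add_left k₀ k).trans (Nat.le_mul_of_pos_right _ (Nat.succ_pos l))
  have hmsucc : ∀ k, m (k + 1) = m k + d := fun k => by simp only [hm]; ring
  have hmT : Tendsto m atTop atTop :=
    (strictMono_nat_of_lt_succ fun k => by rw [hmsucc]; omega).tendsto_atTop
  set x : ℕ → ℕ := fun k => a (m k) with hx
  set c : ℕ → ℕ := fun k => r (m k) with hc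
  have hxc : ∀ k, x k + c k < x (k + 1) := fun k => by
    simp only [hx, hc]
    rw [hmsucc]
    exact hk₀ _ (hmge k)
  have hxm : StrictMono x := strictMono_nat_of_lt_succ fun k =>
    (Nat.le_add_right _ _).trans_lt (hxc k)
  set pos := Nat.nth (IsFreePos x c) with hposdef
  have hposm : StrictMono pos := Nat.nth_strictMono (infinite_isFreePos hxm hxc)
  have hxlim : Tendsto (fun k => (x (k + 1) : ℝ) / x k) atTop (𝓝 (η * t)) := by
    rw [ht, ← pow_succ']
    refine ((tendsto_ratio_add ha ha0 hlim d).comp hmT).congr fun k => ?_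
    simp only [hx, Function.comp, hmsucc]
  have hclim : Tendsto (fun k => (c k : ℝ) / x k) atTop (𝓝 (t * v)) := hrlim.comp hmT
  -- With `u = η * t` and `q = t * v`, the density condition `q * u / (u - 1) < (1 - s) * (1 + q)`
  -- rearranges to `s < dimFun η v t`.
  have hfree : ∀ s < dimFun η v t, ∃ C, ∀ J, s * pos J ≤ J + C := by
    intro s hs
    rw [dimFun, lt_div_iff₀ hden] at hs
    have hs1 : s ≤ 1 := by
      by_contra hcon
      push Not at hcon
      have : 0 < t * v := by positivity
      nlinarith
    obtain ⟨C, hC0, hC⟩ := exists_sum_le_of_tendsto (s := s)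
      (fun k => ha0.trans_le (ha.monotone (Nat.zero_le _)))
      (by nlinarith) hs1 hxlim hclim (by rw [div_lt_iff₀ (by nlinarith)]; linarith)
    exact ⟨C, mul_nth_isFreePos_le hxm hxc hs1 hC0 hC⟩
  have hmem : ∀ y, spread b pos y ∈ uniformGeSet b a v := by
    intro y
    suffices h : ∀ᶠ N in atTop, ∃ n, n ≤ N ∧ distNearestInt ((b : ℝ) ^ (a n) * spread b pos y) <
        ((b : ℝ) ^ (a N)) ^ (-v) from by
      have hv' : v ∈ {v : ℝ | 0 ≤ v ∧ ∀ᶠ N in atTop, ∃ n, n ≤ N ∧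
          distNearestInt ((b : ℝ) ^ (a n) * spread b pos y) < ((b : ℝ) ^ (a N)) ^ (-v)} := ⟨hv.le, h⟩
      change (v : EReal) ≤ uniformExponent b a _
      exact le_sSup (mem_image_of_mem (fun v : ℝ => (v : EReal)) hv')
    filter_upwards [eventually_ge_atTop (m 0)] with N hN
    have hN' : m 0 = k₀ * d := by simp only [hm, zero_add]
    have hdpos : 0 < d := Nat.succ_pos l
    have h1 : k₀ ≤ N / d := by rw [Nat.le_div_iff_mul_le hdpos, ← hN']; exact hN
    have h2 : m (N / d - k₀) = N / d * d := by
      simp only [hm]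
      rw [Nat.sub_add_cancel h1]
    have h3 := Nat.div_add_mod' N d
    have h4 := Nat.mod_lt N hdpos
    refine ⟨m (N / d - k₀), by omega, ?_⟩
    refine (distNearestInt_spread_le hb hxm hxc y (N / d - k₀)).trans_lt ?_
    rw [pow_rpow_neg, one_div, ← Real.rpow_natCast, ← Real.rpow_neg (by positivity)]
    apply Real.rpow_lt_rpow_of_exponent_lt hb1
    have h5 : a N ≤ a (m (N / d - k₀) + l) := ha.monotone (by omega)
    have h6 : (a N : ℝ) ≤ a (m (N / d - k₀) + l) := by exact_mod_cast h5
    have h7 : v * a (m (N / d - k₀) + l) < (c (N / d - k₀) : ℝ) := by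
      simp only [hc, hr]
      push_cast
      exact Nat.lt_floor_add_one _
    have : v * a N ≤ v * a (m (N / d - k₀) + l) := by gcongr
    linarith
  have hnull : ∀ v', v < v' →
      dimH {y ∈ Ico (0 : ℝ) 1 | spread b pos y ∈ uniformGeSet b a v'} < 1 := by
    intro v' hv'
    -- Choosing `D' < s < dimFun η v t`, the image has dimension at most `D'` and the preimage at
    -- most `D' / s < 1`.
    obtain ⟨D', hD0, hD', hle⟩ := dimFun_lt_of_lt hη hv hv' hpos hmax
    obtain ⟨s, hs1, hs2⟩ := exists_between hD'
    obtain ⟨C, hC⟩ := hfree s hs2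
    have hs0 : 0 < s := hD0.trans hs1
    lift s to NNReal using hs0.le
    have hs0' : (0 : NNReal) < s := by exact_mod_cast hs0
    refine (dimH_le_dimH_spread_image hb hposm hs0' hC fun y hy => hy.1).trans_lt ?_
    have h1 : dimH (spread b pos '' {y ∈ Ico (0 : ℝ) 1 | spread b pos y ∈ uniformGeSet b a v'}) <
        s := by
      refine lt_of_le_of_lt (dimH_mono ?_) (lt_of_le_of_lt
        (dimH_uniformGeSet_le hb ha ha0 hη hlim (hv.trans hv') hD0.le hle) ?_)
      · rintro _ ⟨y, hy, rfl⟩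
        exact hy.2
      · rw [← ENNReal.ofReal_coe_nnreal]
        exact (ENNReal.ofReal_lt_ofReal_iff hs0).2 hs1
    rw [ENNReal.div_lt_iff (Or.inl (by exact_mod_cast hs0'.ne')) (Or.inl ENNReal.coe_ne_top),
      one_mul]
    exact h1
  set A := {y ∈ Ico (0 : ℝ) 1 | spread b pos y ∈ uniformEqSet b a v} with hA
  have hA1 : 1 ≤ dimH A := by
    refine one_le_dimH_of_subset_union (B := fun j : ℕ => {y ∈ Ico (0 : ℝ) 1 |
      spread b pos y ∈ uniformGeSet b a (v + 1 / ((j : ℝ) + 1))}) (fun y hy => ?_)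
      fun j => hnull _ (lt_add_of_pos_right _ (by positivity))
    by_cases h : ∃ j : ℕ, spread b pos y ∈ uniformGeSet b a (v + 1 / ((j : ℝ) + 1))
    · obtain ⟨j, hj⟩ := h
      exact Or.inr (mem_iUnion.2 ⟨j, hy, hj⟩)
    · push Not at h
      exact Or.inl ⟨hy, mem_uniformEqSet_of_notMem (hmem y) h⟩
  refine le_of_forall_lt fun e he => ?_
  obtain ⟨s, hes, hs⟩ := ENNReal.lt_iff_exists_nnreal_btwn.1 he
  rw [← ENNReal.ofReal_coe_nnreal, ENNReal.ofReal_lt_ofReal_iff hpos] at hs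
  obtain ⟨C, hC⟩ := hfree s hs
  have hs0 : 0 < s := ENNReal.coe_pos.1 (pos_of_gt hes)
  refine hes.trans_le ?_
  have h1 := hA1.trans (dimH_le_dimH_spread_image hb hposm hs0 hC fun y hy => hy.1)
  rw [ENNReal.le_div_iff_mul_le (Or.inl (by exact_mod_cast hs0.ne')) (Or.inl ENNReal.coe_ne_top),
    one_mul] at h1
  refine h1.trans (dimH_mono ?_)
  rintro _ ⟨y, hy, rfl⟩
  exact hy.2

/-! ### Assembling both bounds. -/

theorem dimH_eq_of_mem_exponentRange {b : ℕ} (hb : 2 ≤ b) {a : ℕ → ℕ} (ha : StrictMono a)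
    (ha0 : 0 < a 0) {η v : ℝ} (hη : 1 < η)
    (hlim : Tendsto (fun n : ℕ => (a (n + 1) : ℝ) / (a n : ℝ)) atTop (𝓝 η))
    (hv : v ∈ exponentRange η) :
    dimH (uniformEqSet b a v) = ENNReal.ofReal (dimValue η v) ∧
      dimH (uniformGeSet b a v) = ENNReal.ofReal (dimValue η v) := by
  obtain ⟨l, hl, hlt, hv0, h2, h3⟩ := exists_level_of_mem_exponentRange hη hv
  rw [dimValue_eq_dimFun hη hlt]
  have ht : ∀ d : ℕ, 1 ≤ η ^ d := fun d => one_le_pow₀ hη.le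
  have hpos := dimFun_pos_of_two_le hv0 (ht l) h2
  have hmax : ∀ d : ℕ, dimFun η v (η ^ d) ≤ dimFun η v (η ^ l) := fun d => by
    refine dimFun_le_dimFun hη hv0 (ht l) (ht d) h2 h3 ?_
    -- Exponents are integers, so `d < l` already gives a full factor `η`.
    rcases le_or_gt l d with h | h
    · exact Or.inl (pow_le_pow_right₀ hη.le h)
    · rw [← pow_succ']
      exact Or.inr (pow_le_pow_right₀ hη.le h)
  have hsub : uniformEqSet b a v ⊆ uniformGeSet b a v := fun ξ hξ => ge_of_eq hξ
  have hlow := le_dimH_uniformEqSet hb ha ha0 hη hlim hv0 hpos hmax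
  have hup := dimH_uniformGeSet_le hb ha ha0 hη hlim hv0 hpos.le hmax
  exact ⟨le_antisymm ((dimH_mono hsub).trans hup) hlow,
    le_antisymm hup (hlow.trans (dimH_mono hsub))⟩

theorem corollary16 (b : ℕ) (hb : 2 ≤ b) (a : ℕ → ℕ) (ha : StrictMono a) (ha0 : 0 < a 0)
    (η : ℝ) (hη : 1 < η)
    (hlim : Tendsto (fun n : ℕ => (a (n + 1) : ℝ) / (a n : ℝ)) atTop (𝓝 η)) :
    (∀ v ∈ exponentRange η,
      dimH (uniformEqSet b a v) = ENNReal.ofReal (dimValue η v) ∧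
      dimH (uniformGeSet b a v) = ENNReal.ofReal (dimValue η v)) ∧
    (∀ l : ℤ, lZero η ≤ l → ∀ v : ℝ, v = η - 2 / η ^ l →
      dimH (uniformEqSet b a v) = ENNReal.ofReal (dimValue η v) ∧
      dimH (uniformGeSet b a v) = ENNReal.ofReal (dimValue η v) ∧
      dimValue η v = ((η - v) / (η + v)) ^ 2) := by
  refine ⟨fun v hv => dimH_eq_of_mem_exponentRange hb ha ha0 hη hlim hv, ?_⟩
  rintro l hl v rfl
  obtain ⟨h1, h2⟩ := dimH_eq_of_mem_exponentRange hb ha ha0 hη hlim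
    (upperEnd_mem_exponentRange hη hl)
  exact ⟨h1, h2, dimValue_upperEnd hη hl⟩
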